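/- Let $q$ be an indeterminate and let $\Lambda$ be the ring of symmetric functions over $\mathbb{Q}(q)$, which is the polynomial ring over $\mathbb{Q}(q)$ in the power sums $p_1,p_2,\dots$. For a partition $\lambda$ with conjugate $\lambda'$, length $l(\lambda)$ and multiplicities $m_i(\lambda)$ ($i\ge 1$), let $(q;q)_k=(1-q)(1-q^2)\cdots(1-q^k)$ and $b_\lambda(q)=\prod_{i\ge 1}(q;q)_{m_i(\lambda)}$. Let $P_\lambda\in\Lambda$ be the Hall–Littlewood symmetric function, i.e. the symmetric function such that for all $N\ge l(\lambda)$, with $m_0(\lambda)=N-l(\lambda)$, $$P_\lambda(x_1,\dots,x_N;q)=\Bigg(\prod_{i\ge 0}\frac{(q;q)_{m_i(\lambda)}}{(1-q)^{m_i(\lambda)}}\Bigg)^{-1}\sum_{w\in S_N} w\Bigg(x_1^{\lambda_1}\cdots x_N^{\lambda_N}\prod_{1\le i<j\le N}\frac{x_i-qx_j}{x_i-x_j}\Bigg),$$ where $S_N$ permutes the variables, and let $Q_\lambda=b_\lambda(q)P_\lambda$. For $x=(x_1,\dots,x_n)$ the modified Hall–Littlewood polynomials are $$Q'_\lambda(x;q)=Q_\lambda\Big(\frac{x}{1-q};q\Big),\qquad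 P'_\lambda(x;q)=\frac{Q'_\lambda(x;q)}{b_\lambda(q)},$$ where $F\mapsto F\big(x/(1-q)\big)$ is the ring homomorphism over $\mathbb{Q}(q)$ with $p_r\mapsto (x_1^r+\cdots+x_n^r)/(1-q^r)$ for $r\ge 1$ (each $x_i$ is replaced by $x_i,x_iq,x_iq^2,\dots$). For an integer $m\ge 0$ let $(a;q)_m=\prod_{k=0}^{m-1}(1-aq^k)$ and $(a;q)_{-m}=\prod_{k=1}^{m}(1-aq^{-k})^{-1}$. For $r,s\in\mathbb{N}^n$ with $r\supseteq s$ (i.e. $r_i\ge s_i$ for all $i$), where $\mathbb{N}=\{0,1,2,\dots\}$, let $$f^{(1)}_{r,s}(x;q)=\prod_{i=1}^n x_i^{r_i}q^{\binom{r_i}{2}}\prod_{i,j=1}^n\frac{(qx_i/x_j;q)_{r_i-r_j}}{(qx_i/x_j;q)_{r_i-s_j}}.$$ **Theorem.** For every $n\ge 0$ and every partition $\lambda$ (of arbitrary length), in $\mathbb{Q}(q)(x_1,\dots,x_n)$, $$P'_\lambda(x;q)=\sum\ \prod_{\ell\ge 1} f^{(1)}_{r^{(\ell)},r^{(\ell+1)}}(x;q),$$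 where the (finite) sum is over all sequences $r^{(1)}\supseteq r^{(2)}\supseteq\cdots$ in $\mathbb{N}^n$ with $|r^{(\ell)}|:=r^{(\ell)}_1+\cdots+r^{(\ell)}_n=\lambda'_\ell$ for all $\ell\ge 1$. In each summand only finitely many factors differ from $1$, because $r^{(\ell)}=0$ for $\ell>\lambda_1$. -/

import Mathlib

/-- The field `ℚ(q)`. -/
abbrev QField : Type := RatFunc ℚ

/-- The indeterminate `q` of `ℚ(q)`. -/
noncomputable def qVar : QField := RatFunc.X

/-- The ring `Λ` of symmetric functions over `ℚ(q)`, presented as the polynomial ring in the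
power sums `p_1, p_2, …`: the generator `X r` stands for `p_r`. -/
abbrev SymmFun : Type := MvPolynomial ℕ+ QField

/-- The symmetric polynomial `F(x_1, …, x_N)` of a symmetric function `F`. -/
noncomputable def SymmFun.inVars (N : ℕ) : SymmFun →ₐ[QField] MvPolynomial (Fin N) QField :=
  MvPolynomial.aeval fun r : ℕ+ => MvPolynomial.psum (Fin N) QField (r : ℕ)

/-- The plethystic substitution `F(x) ↦ F(x / (1 - q))`, that is, the ring homomorphism
`p_r ↦ p_r / (1 - q ^ r)`; it replaces each variable `x_i` by the variables
`x_i, x_i q, x_i q ^ 2, …`, since `∑ k, (x_i q ^ k) ^ r = x_i ^ r / (1 - q ^ r)`. -/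
noncomputable def plethysmDivOneSub : SymmFun →ₐ[QField] SymmFun :=
  MvPolynomial.aeval fun r : ℕ+ =>
    MvPolynomial.C (1 - qVar ^ (r : ℕ))⁻¹ * MvPolynomial.X r

section Field

variable {L : Type*} [Field L]

/-- The `q`-shifted factorial `(a; q)_m` for an arbitrary integer `m`. This is
`(a; q)_∞ / (a q ^ m; q)_∞` with the common factors cancelled: for `m ≥ 0` it is
`(1 - a) (1 - a q) ⋯ (1 - a q ^ (m - 1))`, and
`(a; q)_{-m} = 1 / ((1 - a q ^ (-1)) ⋯ (1 - a q ^ (-m)))`. -/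
def qPoch (a q : L) : ℤ → L
  | Int.ofNat m => ∏ k ∈ Finset.range m, (1 - a * q ^ k)
  | Int.negSucc m => (∏ k ∈ Finset.range (m + 1), (1 - a * (q⁻¹) ^ (k + 1)))⁻¹

/-- `b_lam(q) = ∏_{i ≥ 1} (q; q)_{m_i(lam)}`, where `m_i(lam)` is the multiplicity of the
part `i` in `lam`. -/
def hlB (lam : YoungDiagram) (q : L) : L :=
  ∏ i ∈ Finset.range (lam.rowLen 0), qPoch q q (lam.rowLens.count (i + 1) : ℕ)

/-- `v_lam(q) = ∏_{i ≥ 0} (q; q)_{m_i(lam)} / (1 - q) ^ m_i(lam)` for a partition `lam` of length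
at most `N`, where `m_0(lam) = N - l(lam)`. -/
def hlV (N : ℕ) (lam : YoungDiagram) (q : L) : L :=
  (qPoch q q (N - lam.colLen 0 : ℕ) / (1 - q) ^ (N - lam.colLen 0)) *
    ∏ i ∈ Finset.range (lam.rowLen 0),
      (qPoch q q (lam.rowLens.count (i + 1) : ℕ) / (1 - q) ^ lam.rowLens.count (i + 1))

/-- The symmetrisation formula for the Hall–Littlewood polynomial `P_lam(y_1, …, y_N; q)` of a
partition `lam` of length at most `N`, evaluated at pairwise distinct elements of a field:
`1 / v_lam(q) * ∑_{w ∈ S_N} w (y ^ lam ∏_{i < j} (y_i - q y_j) / (y_i - y_j))`. -/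
def hlSymmetrization (N : ℕ) (lam : YoungDiagram) (y : Fin N → L) (q : L) : L :=
  (hlV N lam q)⁻¹ * ∑ w : Equiv.Perm (Fin N),
    (∏ i, y (w i) ^ lam.rowLen i) *
      ∏ i, ∏ j ∈ Finset.Ioi i, (y (w i) - q * y (w j)) / (y (w i) - y (w j))

/-- The `q`-hypergeometric term `f_{r,s}^{(τ)}(x; q)`. -/
def hyperTerm {n : ℕ} (τ : ℤ) (r s : Fin n → ℕ) (x : Fin n → L) (q : L) : L :=
  (∏ i, (x i ^ r i * q ^ (r i).choose 2) ^ τ) *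
    ∏ i, ∏ j, qPoch (q * x i / x j) q ((r i : ℤ) - (r j : ℤ)) /
      qPoch (q * x i / x j) q ((r i : ℤ) - (s j : ℤ))

end Field

/-- The field `ℚ(q)(x_1, …, x_n)`. -/
abbrev RatFun (n : ℕ) : Type := FractionRing (MvPolynomial (Fin n) QField)

/-- The variable `x_i` as an element of `ℚ(q)(x_1, …, x_n)`. -/
noncomputable def RatFun.x {n : ℕ} (i : Fin n) : RatFun n :=
  algebraMap (MvPolynomial (Fin n) QField) (RatFun n) (MvPolynomial.X i)

/-- The element `q` of `ℚ(q)(x_1, …, x_n)`. -/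
noncomputable def RatFun.q (n : ℕ) : RatFun n :=
  algebraMap (MvPolynomial (Fin n) QField) (RatFun n) (MvPolynomial.C qVar)

/-- `F` is the Hall–Littlewood symmetric function of `lam`: for every `N ≥ l(lam)`, the polynomial
`F(x_1, …, x_N)` is the Hall–Littlewood polynomial `P_lam(x_1, …, x_N; q)`. -/
def IsHallLittlewood (lam : YoungDiagram) (F : SymmFun) : Prop :=
  ∀ N : ℕ, lam.colLen 0 ≤ N →
    algebraMap (MvPolynomial (Fin N) QField) (RatFun N) (SymmFun.inVars N F) =
      hlSymmetrization N lam RatFun.x (RatFun.q N)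

/-- The Hall–Littlewood symmetric function `P_lam`, the only symmetric function with
`IsHallLittlewood lam P_lam`. -/
noncomputable def hallLittlewoodP (lam : YoungDiagram) : SymmFun :=
  Classical.epsilon (IsHallLittlewood lam)

/-- The Hall–Littlewood symmetric function `Q_lam = b_lam(q) P_lam`. -/
noncomputable def hallLittlewoodQ (lam : YoungDiagram) : SymmFun :=
  MvPolynomial.C (hlB lam qVar) * hallLittlewoodP lam

/-- The modified Hall–Littlewood polynomial `Q'_lam(x; q) = Q_lam(x / (1 - q); q)` in
`x = (x_1, …, x_n)`. -/
noncomputable def modifiedQ (n : ℕ) (lam : YoungDiagram) : MvPolynomial (Fin n) QField :=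
  SymmFun.inVars n (plethysmDivOneSub (hallLittlewoodQ lam))

/-- The modified Hall–Littlewood polynomial `P'_lam(x; q) = Q'_lam(x; q) / b_lam(q)` in
`x = (x_1, …, x_n)`. -/
noncomputable def modifiedP (n : ℕ) (lam : YoungDiagram) : MvPolynomial (Fin n) QField :=
  MvPolynomial.C (hlB lam qVar)⁻¹ * modifiedQ n lam

/-- The set of sequences `r^{(1)} ⊇ r^{(2)} ⊇ ⋯` in `ℕ ^ n` with `|r^{(ℓ)}| = lam'_ℓ` for all
`ℓ ≥ 1`. Here `r ℓ` is `r^{(ℓ + 1)}` and `lam.colLen ℓ` is `lam'_{ℓ + 1}`. -/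
def chainSet (n : ℕ) (lam : YoungDiagram) : Set (ℕ → Fin n → ℕ) :=
  {r | Antitone r ∧ ∀ l, ∑ i, r l i = lam.colLen l}

theorem colLen_eq_zero_of_rowLen_le (lam : YoungDiagram) {l : ℕ} (h : lam.rowLen 0 ≤ l) :
    lam.colLen l = 0 := by
  by_contra hne
  have h1 : (0, l) ∈ lam := YoungDiagram.mem_iff_lt_colLen.2 (Nat.pos_of_ne_zero hne)
  have h2 := YoungDiagram.mem_iff_lt_rowLen.1 h1
  omega

theorem eq_zero_of_mem_chainSet {n : ℕ} {lam : YoungDiagram} {r : ℕ → Fin n → ℕ}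
    (hr : r ∈ chainSet n lam) {l : ℕ} (h : lam.rowLen 0 ≤ l) : r l = 0 := by
  have h1 := hr.2 l
  rw [colLen_eq_zero_of_rowLen_le lam h, Finset.sum_eq_zero_iff] at h1
  funext i
  exact h1 i (Finset.mem_univ i)

theorem chainSet_finite (n : ℕ) (lam : YoungDiagram) : (chainSet n lam).Finite := by
  let g : (ℕ → Fin n → ℕ) → (Fin (lam.rowLen 0) → Fin n → ℕ) := fun r l => r l
  have hb : (Set.Iic (fun (_ : Fin (lam.rowLen 0)) (_ : Fin n) => lam.colLen 0)).Finite :=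
    Set.finite_Iic _
  refine Set.Finite.of_finite_image (f := g) (hb.subset ?_) ?_
  · rintro _ ⟨r, hr, rfl⟩ l i
    calc r l i ≤ r 0 i := hr.1 (Nat.zero_le _) i
      _ ≤ ∑ i, r 0 i := Finset.single_le_sum (fun _ _ => Nat.zero_le _) (Finset.mem_univ i)
      _ = lam.colLen 0 := hr.2 0
  · intro r hr s hs hrs
    funext l
    by_cases h : l < lam.rowLen 0
    · exact congrFun hrs ⟨l, h⟩
    · rw [eq_zero_of_mem_chainSet hr (not_lt.1 h), eq_zero_of_mem_chainSet hs (not_lt.1 h)]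

/-- The finite set of the chains `r^{(1)} ⊇ r^{(2)} ⊇ ⋯` in `ℕ ^ n` with
`|r^{(ℓ)}| = lam'_ℓ`. -/
noncomputable def chains (n : ℕ) (lam : YoungDiagram) : Finset (ℕ → Fin n → ℕ) :=
  (chainSet_finite n lam).toFinset

theorem hyperTerm_zero_zero {L : Type*} [Field L] {n : ℕ} (τ : ℤ) (x : Fin n → L) (q : L) :
    hyperTerm τ 0 0 x q = 1 := by
  have h0 : ∀ a : L, qPoch a q 0 = 1 := fun a => Finset.prod_range_zero _
  simp [hyperTerm, h0]

/-- For a chain, the product over all `ℓ ≥ 1` has only finitely many factors different from `1`. -/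
theorem mulSupport_hyperTerm_finite {L : Type*} [Field L] {n : ℕ} {lam : YoungDiagram}
    {r : ℕ → Fin n → ℕ} (hr : r ∈ chains n lam) (x : Fin n → L) (q : L) :
    (Function.mulSupport fun l => hyperTerm 1 (r l) (r (l + 1)) x q).Finite := by
  have hr' : r ∈ chainSet n lam := (chainSet_finite n lam).mem_toFinset.1 hr
  refine (Set.finite_Iio (lam.rowLen 0)).subset fun l hl => ?_
  by_contra h
  have h1 : lam.rowLen 0 ≤ l := not_lt.1 h
  apply hl
  simp only [eq_zero_of_mem_chainSet hr' h1,
    eq_zero_of_mem_chainSet hr' (h1.trans (Nat.le_succ l)), hyperTerm_zero_zero]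

/-! Take finitely many points `y_i`, `i ∈ S`. Grouping the permutations in the symmetrisation by the
set `R` of variables that occupy the first `λ'_1` positions gives `P_λ(S) = ∑_R ∏_{i ∈ R, j ∈ S \ R}
(y_i - q y_j) / (y_i - y_j) · ∏_{i ∈ R} y_i · P_μ(R)`, where `|R| = λ'_1` and `μ` is `λ` without its
first column (`hlColumn_recursion`).

Apply this to the points `x_i q^k` with `0 ≤ k < r_i`. The weight of `R` vanishes if `R` contains
`x_i q^(k+1)` but not `x_i q^k`, so only sets of the same shape survive (`exists_eq_box`), and the
iterated recursion becomes a sum over chains in `ℕ^n`. The weights telescope (`prod_box_hlWeight`)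
and regroup into the terms `f_{r,s}` (`hyperTerm_eq`), leaving one extra factor for the outermost
box (`hlColumn_box`).

If all `r_i = M`, then `p_r` takes the value `p_r(x) (1 - z^r) / (1 - q^r)` with `z = q^M`, and the
extra factor depends on `M` only through `z`. Both sides are polynomials in `z` that agree at
infinitely many `z = q^M`, hence at `z = 0`, where the left side is `P'_λ` and the extra factor is
`1` (`algebraMap_modifiedP_eq_sum`). This replaces the limit `M → ∞`.

Since `hallLittlewoodP` is a choice, existence of `P_λ` has to be established
(`exists_isHallLittlewood`): the symmetrisation is a homogeneous symmetric polynomial, compatible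
with setting the last variable to zero. -/

/-! ### Sums over orderings of a finite set. -/

section OrderSum

variable {ι L : Type*} [DecidableEq ι] [CommRing L]

/-- The sum over all orderings `i_0, i_1, …` of the `k`-element set `S` of
`∏ m, y (i_m) ^ e m * ∏ l < m, a (i_l) (i_m)`. -/
def orderSum (a : ι → ι → L) (y : ι → L) : ℕ → (ℕ → ℕ) → Finset ι → L
  | 0, _, _ => 1
  | k + 1, e, S => ∑ i ∈ S, y i ^ e 0 * (∏ j ∈ S.erase i, a i j) *
      orderSum a y k (fun m => e (m + 1)) (S.erase i)

theorem orderSum_congr (a : ι → ι → L) (y : ι → L) (k : ℕ) {e e' : ℕ → ℕ} (S : Finset ι)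
    (h : ∀ i < k, e i = e' i) : orderSum a y k e S = orderSum a y k e' S := by
  induction k generalizing e e' S with
  | zero => rfl
  | succ k ih =>
    simp only [orderSum]
    refine Finset.sum_congr rfl fun i _ => ?_
    rw [h 0 (Nat.succ_pos k), ih (e' := fun m => e' (m + 1)) _ fun m hm => h (m + 1) (by omega)]

theorem sum_perm_eq_orderSum (a : ι → ι → L) (y : ι → L) (N : ℕ) (e : ℕ → ℕ) (f : Fin N ↪ ι) :
    ∑ w : Equiv.Perm (Fin N), (∏ i, y (f (w i)) ^ e i) *
        ∏ i, ∏ j ∈ Finset.Ioi i, a (f (w i)) (f (w j)) =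
      orderSum a y N e (Finset.univ.map f) := by
  induction N generalizing e with
  | zero => simp [orderSum]
  | succ N ih =>
    rw [← Equiv.Perm.decomposeFin.symm.sum_comp, Fintype.sum_prod_type, orderSum,
      Finset.sum_map]
    refine Finset.sum_congr rfl fun p _ => ?_
    -- `decomposeFin` splits a permutation into the image `p` of `0` and a permutation of the rest;
    -- `g` enumerates the points other than `f p` in the matching order.
    let g : Fin N ↪ ι := ((Fin.succEmb N).trans (Equiv.swap 0 p).toEmbedding).trans f
    have hg : (Finset.univ.map f).erase (f p) = Finset.univ.map g := by
      ext t
      simp only [Finset.mem_erase, Finset.mem_map, Finset.mem_univ, true_and]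
      constructor
      · rintro ⟨h, s, rfl⟩
        have hs : Equiv.swap 0 p s ≠ 0 := by
          intro h0
          have : s = p := by simpa using congrArg (Equiv.swap 0 p) h0
          exact h (by rw [this])
        obtain ⟨m, hm⟩ := Fin.exists_succ_eq.2 hs
        refine ⟨m, ?_⟩
        simp [g, hm]
      · rintro ⟨m, rfl⟩
        refine ⟨fun h => ?_, ⟨_, rfl⟩⟩
        have h1 := f.injective h
        have h2 := congrArg (Equiv.swap 0 p) h1
        simp at h2
    rw [hg, ← ih, Finset.mul_sum]
    refine Finset.sum_congr rfl fun w _ => ?_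
    have hsucc : ∀ m : Fin N, f (Equiv.Perm.decomposeFin.symm (p, w) m.succ) = g (w m) := by
      intro m
      simp [g]
    rw [Fin.prod_univ_succ, Fin.prod_univ_succ, Fin.prod_Ioi_zero]
    simp only [Fin.prod_Ioi_succ, hsucc, Equiv.Perm.decomposeFin_symm_apply_zero, Fin.val_zero,
      Fin.val_succ, Finset.prod_map]
    rw [Equiv.prod_comp w fun m => a (f p) (g m)]
    ring

/-- `R` is the set of the first `l` elements of the ordering. In the induction, a first element `i`
and the set `R` of the next `l` correspond to the set `insert i R` with a marked element. -/
theorem orderSum_add (a : ι → ι → L) (y : ι → L) (l k : ℕ) (e : ℕ → ℕ) (S : Finset ι) :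
    orderSum a y (l + k) e S = ∑ R ∈ S.powersetCard l, (∏ i ∈ R, ∏ j ∈ S \ R, a i j) *
      orderSum a y l e R * orderSum a y k (fun m => e (m + l)) (S \ R) := by
  induction l generalizing e S with
  | zero => simp [orderSum]
  | succ l ih =>
    rw [Nat.add_right_comm, orderSum]
    simp only [ih, orderSum, Finset.mul_sum, Finset.sum_mul]
    rw [Finset.sum_sigma', Finset.sum_sigma']
    refine Finset.sum_bij' (fun t _ => ⟨insert t.1 t.2, t.1⟩) (fun t _ => ⟨t.2, t.1.erase t.2⟩)
      ?_ ?_ ?_ ?_ ?_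
    · rintro ⟨i, R⟩ h
      simp only [Finset.mem_sigma, Finset.mem_powersetCard] at h ⊢
      obtain ⟨hi, hR, hc⟩ := h
      have hiR : i ∉ R := fun h => (Finset.mem_erase.1 (hR h)).1 rfl
      exact ⟨⟨Finset.insert_subset hi (hR.trans (Finset.erase_subset _ _)),
        by rw [Finset.card_insert_of_notMem hiR, hc]⟩, Finset.mem_insert_self _ _⟩
    · rintro ⟨R, i⟩ h
      simp only [Finset.mem_sigma, Finset.mem_powersetCard] at h ⊢
      obtain ⟨⟨hR, hc⟩, hi⟩ := h
      exact ⟨hR hi, Finset.erase_subset_erase _ hR, by rw [Finset.card_erase_of_mem hi, hc]; rfl⟩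
    · rintro ⟨i, R⟩ h
      simp only [Finset.mem_sigma, Finset.mem_powersetCard] at h ⊢
      obtain ⟨hi, hR, hc⟩ := h
      have hiR : i ∉ R := fun h => (Finset.mem_erase.1 (hR h)).1 rfl
      simp [Finset.erase_insert hiR]
    · rintro ⟨R, i⟩ h
      simp only [Finset.mem_sigma, Finset.mem_powersetCard] at h ⊢
      simp [Finset.insert_erase h.2]
    · rintro ⟨i, R⟩ h
      simp only [Finset.mem_sigma, Finset.mem_powersetCard] at h ⊢
      obtain ⟨hi, hR, hc⟩ := h
      have hiR : i ∉ R := fun h => (Finset.mem_erase.1 (hR h)).1 rfl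
      have h1 : S \ insert i R = S.erase i \ R := by
        ext; simp only [Finset.mem_sdiff, Finset.mem_insert, Finset.mem_erase]; tauto
      rw [h1, Finset.erase_insert hiR, Finset.prod_insert hiR, ← Finset.prod_sdiff hR]
      simp only [Nat.add_assoc]
      ring

theorem orderSum_add_one (a : ι → ι → L) (y : ι → L) (k : ℕ) (e : ℕ → ℕ) {S : Finset ι}
    (hS : S.card = k) :
    orderSum a y k (fun m => e m + 1) S = (∏ i ∈ S, y i) * orderSum a y k e S := by
  induction k generalizing e S with
  | zero => simp [orderSum, Finset.card_eq_zero.1 hS]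
  | succ k ih =>
    simp only [orderSum]
    rw [Finset.mul_sum]
    refine Finset.sum_congr rfl fun i hi => ?_
    rw [ih (fun m => e (m + 1)) (by rw [Finset.card_erase_of_mem hi, hS]; rfl),
      ← Finset.mul_prod_erase S y hi]
    ring

end OrderSum

/-! ### The symmetrisation identity for the weights, and splitting off a column. -/

section HallLittlewoodWeight

variable {ι L : Type*} [DecidableEq ι] [Field L]

/-- The weight `(y_i - q y_j) / (y_i - y_j)` of an ordered pair. -/
def hlWeight (q : L) (y : ι → L) (i j : ι) : L := (y i - q * y j) / (y i - y j)

/-- The `q`-factorial `(q; q)_k / (1 - q) ^ k`. -/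
def qFact (q : L) (k : ℕ) : L := qPoch q q (k : ℕ) / (1 - q) ^ k

theorem qPoch_natCast (a q : L) (k : ℕ) :
    qPoch a q (k : ℤ) = ∏ i ∈ Finset.range k, (1 - a * q ^ i) := rfl

theorem qFact_zero (q : L) : qFact q 0 = 1 := by simp [qFact, qPoch]

theorem qFact_succ (q : L) (k : ℕ) :
    qFact q (k + 1) = (1 - q ^ (k + 1)) / (1 - q) * qFact q k := by
  rw [qFact, qFact, qPoch_natCast, qPoch_natCast, Finset.prod_range_succ, pow_succ (1 - q),
    ← pow_succ', mul_div_mul_comm, mul_comm]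

-- Lagrange interpolation of `∏ (X - q y_j) - ∏ (X - y_j)` at the nodes `y_i`, evaluated at `0`. The
-- leading terms cancel, so the degree is less than the number of nodes; nonzero `y_j` allow
-- division by `∏ (-y_j)`.
open Polynomial in
theorem sum_hlWeight_of_ne_zero {q : L} (hq : q ≠ 1) {y : ι → L} {S : Finset ι}
    (hy : Set.InjOn y S) (h0 : ∀ i ∈ S, y i ≠ 0) :
    ∑ i ∈ S, ∏ j ∈ S.erase i, hlWeight q y i j = (1 - q ^ S.card) / (1 - q) := by
  have hq' : 1 - q ≠ 0 := sub_ne_zero.2 hq.symm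
  let p : L[X] := ∏ j ∈ S, (X - C (q * y j)) - ∏ j ∈ S, (X - C (y j))
  have hdeg : p.degree < S.card := by
    have h1 : (∏ j ∈ S, (X - C (q * y j))).degree = (S.card : WithBot ℕ) := by
      rw [degree_prod]; simp only [degree_X_sub_C]; simp
    have h2 : (∏ j ∈ S, (X - C (y j))).degree = (S.card : WithBot ℕ) := by
      rw [degree_prod]; simp only [degree_X_sub_C]; simp
    rw [← h1]
    refine degree_sub_lt_left (h1.trans h2.symm) ?_ ?_
    · exact (monic_prod_of_monic _ _ fun i _ => monic_X_sub_C _).ne_zero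
    · rw [(monic_prod_of_monic _ _ fun i _ => monic_X_sub_C _).leadingCoeff,
        (monic_prod_of_monic _ _ fun i _ => monic_X_sub_C _).leadingCoeff]
  have hint := Lagrange.eq_interpolate hy hdeg
  have hev := congrArg (eval 0) hint
  rw [Lagrange.interpolate_apply, eval_finsetSum] at hev
  have hprod : ∏ j ∈ S, -y j ≠ 0 :=
    Finset.prod_ne_zero_iff.2 fun i hi => neg_ne_zero.2 (h0 i hi)
  have hL : eval 0 p = (q ^ S.card - 1) * ∏ j ∈ S, -y j := by
    simp only [p, eval_sub, eval_prod, eval_X, eval_C, zero_sub, sub_mul, one_mul,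
      ← Finset.prod_const, ← Finset.prod_mul_distrib, mul_neg]
  have hR : ∀ i ∈ S, eval 0 (C (eval (y i) p) * Lagrange.basis S y i) =
      -(1 - q) * (∏ j ∈ S, -y j) * ∏ j ∈ S.erase i, hlWeight q y i j := by
    intro i hi
    have e1 : eval (y i) p = (1 - q) * y i * ∏ j ∈ S.erase i, (y i - q * y j) := by
      simp only [p, eval_sub, eval_prod, eval_X, eval_C]
      rw [Finset.prod_eq_zero (f := fun j => y i - y j) hi (sub_self (y i)), ← Finset.mul_prod_erase S _ hi]
      ring
    rw [eval_mul, eval_C, e1, Lagrange.basis, eval_prod, ← Finset.mul_prod_erase S _ hi]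
    simp only [Lagrange.basisDivisor, eval_mul, eval_C, eval_sub, eval_X, zero_sub, hlWeight,
      div_eq_mul_inv, Finset.prod_mul_distrib]
    ring
  rw [hL, Finset.sum_congr rfl hR, ← Finset.mul_sum] at hev
  rw [eq_div_iff hq']
  apply mul_right_cancel₀ hprod
  linear_combination hev

/-- By injectivity at most one point is zero. Its own term is `q ^ (|S| - 1)`, and in every other
term the weight against it is `1`, which reduces to the nonzero case. -/
theorem sum_hlWeight {q : L} (hq : q ≠ 1) {y : ι → L} {S : Finset ι} (hy : Set.InjOn y S) :
    ∑ i ∈ S, ∏ j ∈ S.erase i, hlWeight q y i j = (1 - q ^ S.card) / (1 - q) := by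
  by_cases h0 : ∀ i ∈ S, y i ≠ 0
  · exact sum_hlWeight_of_ne_zero hq hy h0
  push Not at h0
  obtain ⟨i₀, hi₀, hz⟩ := h0
  have hne : ∀ i ∈ S.erase i₀, y i ≠ 0 := fun i hi h => (Finset.mem_erase.1 hi).1
    (hy (Finset.mem_of_mem_erase hi) hi₀ (h.trans hz.symm))
  have hq' : 1 - q ≠ 0 := sub_ne_zero.2 hq.symm
  rw [← Finset.add_sum_erase S _ hi₀]
  have h1 : ∏ j ∈ S.erase i₀, hlWeight q y i₀ j = q ^ (S.erase i₀).card := by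
    rw [← Finset.prod_const]
    refine Finset.prod_congr rfl fun j hj => ?_
    have := hne j hj
    simp only [hlWeight, hz]
    field_simp
    ring
  have h2 : ∑ i ∈ S.erase i₀, ∏ j ∈ S.erase i, hlWeight q y i j =
      ∑ i ∈ S.erase i₀, ∏ j ∈ (S.erase i₀).erase i, hlWeight q y i j := by
    refine Finset.sum_congr rfl fun i hi => ?_
    have hi' : i₀ ∈ S.erase i := Finset.mem_erase.2 ⟨(Finset.mem_erase.1 hi).1.symm, hi₀⟩
    rw [← Finset.mul_prod_erase _ _ hi', Finset.erase_right_comm]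
    have := hne i hi
    simp [hlWeight, hz, this]
  rw [h1, h2, sum_hlWeight_of_ne_zero hq (hy.mono (by simp)) hne,
    ← Finset.card_erase_add_one hi₀, pow_succ]
  field_simp
  ring

theorem orderSum_hlWeight_zero {q : L} (hq : q ≠ 1) {y : ι → L} (k : ℕ) {S : Finset ι}
    (hS : S.card = k) (hy : Set.InjOn y S) :
    orderSum (hlWeight q y) y k (fun _ => 0) S = qFact q k := by
  induction k generalizing S with
  | zero => simp [orderSum, qFact_zero]
  | succ k ih =>
    simp only [orderSum]
    rw [qFact_succ, ← hS, ← sum_hlWeight hq hy, Finset.sum_mul]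
    refine Finset.sum_congr rfl fun i hi => ?_
    rw [ih (by rw [Finset.card_erase_of_mem hi, hS]; rfl) (hy.mono (by simp))]
    ring

/-- Splitting off the first column of the exponents. -/
theorem orderSum_hlWeight_column {q : L} (hq : q ≠ 1) {y : ι → L} (e : ℕ → ℕ) (l k : ℕ)
    {S : Finset ι} (hS : S.card = l + k) (hy : Set.InjOn y S)
    (hpos : ∀ i < l, 0 < e i) (hzero : ∀ i, l ≤ i → e i = 0) :
    orderSum (hlWeight q y) y (l + k) e S = qFact q k * ∑ R ∈ S.powersetCard l,
      (∏ i ∈ R, ∏ j ∈ S \ R, hlWeight q y i j) * (∏ i ∈ R, y i) *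
        orderSum (hlWeight q y) y l (fun m => e m - 1) R := by
  -- Beyond position `l` all exponents vanish, so the orderings of `S \ R` contribute the factor
  -- `qFact q k`; on `R` one factor of each `y_i` is pulled out.
  rw [orderSum_add, Finset.mul_sum]
  refine Finset.sum_congr rfl fun R hR => ?_
  obtain ⟨hRS, hc⟩ := Finset.mem_powersetCard.1 hR
  rw [show (fun m => e (m + l)) = fun _ => 0 from funext fun m => hzero _ (by omega),
    orderSum_hlWeight_zero hq k (by rw [Finset.card_sdiff_of_subset hRS]; omega)
      (hy.mono (by simp)),
    orderSum_congr (e' := fun m => (e m - 1) + 1) _ _ _ _ fun i hi => by have := hpos i hi; omega,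
    orderSum_add_one _ _ _ (fun m => e m - 1) hc]
  ring

end HallLittlewoodWeight

/-! ### Multiplicities of parts and the column-by-column recursion. -/

namespace YoungDiagram

theorem lt_rowLen_iff_lt_colLen (lam : YoungDiagram) (i j : ℕ) :
    j < lam.rowLen i ↔ i < lam.colLen j := by
  rw [← mem_iff_lt_rowLen, mem_iff_lt_colLen]

theorem count_rowLens (lam : YoungDiagram) (i : ℕ) :
    lam.rowLens.count (i + 1) = lam.colLen i - lam.colLen (i + 1) := by
  have h1 : lam.rowLens.count (i + 1) =
      ((Finset.range (lam.colLen 0)).filter fun m => lam.rowLen m = i + 1).card := by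
    rw [rowLens, List.count_eq_countP, List.countP_map, List.countP_eq_length_filter]
    change _ = Multiset.card (Multiset.filter (fun m => lam.rowLen m = i + 1)
      (Multiset.range (lam.colLen 0)))
    rw [Multiset.range, Multiset.filter_coe, Multiset.coe_card]
    congr 2
  have h2 : ((Finset.range (lam.colLen 0)).filter fun m => lam.rowLen m = i + 1) =
      Finset.Ico (lam.colLen (i + 1)) (lam.colLen i) := by
    ext m
    have e1 := lam.lt_rowLen_iff_lt_colLen m i
    have e2 := lam.lt_rowLen_iff_lt_colLen m (i + 1)
    have e3 := lam.colLen_anti 0 i (Nat.zero_le i)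
    simp only [Finset.mem_filter, Finset.mem_range, Finset.mem_Ico]
    omega
  rw [h1, h2, Nat.card_Ico]

end YoungDiagram

section HallLittlewoodColumn

variable {ι L : Type*} [DecidableEq ι] [Field L]

theorem hlV_eq (N : ℕ) (lam : YoungDiagram) (q : L) :
    hlV N lam q = qFact q (N - lam.colLen 0) *
      ∏ i ∈ Finset.Ico 0 (lam.rowLen 0), qFact q (lam.colLen i - lam.colLen (i + 1)) := by
  simp only [hlV, lam.count_rowLens, qFact, Nat.Ico_zero_eq_range]

theorem hlB_eq (lam : YoungDiagram) (q : L) :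
    hlB lam q = ∏ i ∈ Finset.range (lam.rowLen 0),
      qPoch q q ((lam.colLen i - lam.colLen (i + 1) : ℕ) : ℤ) := by
  simp only [hlB, lam.count_rowLens]

theorem qPoch_self_ne_zero {q : L} (hq : ∀ k, 0 < k → q ^ k ≠ 1) (k : ℕ) :
    qPoch q q (k : ℤ) ≠ 0 := by
  rw [qPoch_natCast]
  refine Finset.prod_ne_zero_iff.2 fun i _ => ?_
  rw [← pow_succ', sub_ne_zero]
  exact (hq _ (Nat.succ_pos i)).symm

theorem qFact_ne_zero {q : L} (hq : ∀ k, 0 < k → q ^ k ≠ 1) (k : ℕ) : qFact q k ≠ 0 := by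
  refine div_ne_zero (qPoch_self_ne_zero hq k) (pow_ne_zero _ (sub_ne_zero.2 ?_))
  simpa using (hq 1 Nat.one_pos).symm

theorem hlB_ne_zero {q : L} (hq : ∀ k, 0 < k → q ^ k ≠ 1) (lam : YoungDiagram) :
    hlB lam q ≠ 0 := by
  rw [hlB_eq]
  exact Finset.prod_ne_zero_iff.2 fun i _ => qPoch_self_ne_zero hq _

theorem hlV_ne_zero {q : L} (hq : ∀ k, 0 < k → q ^ k ≠ 1) (N : ℕ) (lam : YoungDiagram) :
    hlV N lam q ≠ 0 := by
  rw [hlV_eq]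
  exact mul_ne_zero (qFact_ne_zero hq _) (Finset.prod_ne_zero_iff.2 fun i _ => qFact_ne_zero hq _)

/-- The Hall–Littlewood polynomial in the variables `y i`, `i ∈ S`, of the partition obtained from
`lam` by deleting its first `c` columns. -/
def hlColumn (q : L) (y : ι → L) (lam : YoungDiagram) (c : ℕ) (S : Finset ι) : L :=
  (qFact q (S.card - lam.colLen c) *
      ∏ i ∈ Finset.Ico c (lam.rowLen 0), qFact q (lam.colLen i - lam.colLen (i + 1)))⁻¹ *
    orderSum (hlWeight q y) y S.card (fun m => lam.rowLen m - c) S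

theorem hlColumn_of_rowLen_le {q : L} (hq : ∀ k, 0 < k → q ^ k ≠ 1) {y : ι → L}
    (lam : YoungDiagram) {c : ℕ} (hc : lam.rowLen 0 ≤ c) {S : Finset ι} (hy : Set.InjOn y S) :
    hlColumn q y lam c S = 1 := by
  rw [hlColumn, show (fun m => lam.rowLen m - c) = fun _ => 0 from funext fun m => by
      have := lam.rowLen_anti 0 m (Nat.zero_le m); omega,
    orderSum_hlWeight_zero (by simpa using hq 1 Nat.one_pos) _ rfl hy, Finset.Ico_eq_empty_of_le hc,
    colLen_eq_zero_of_rowLen_le lam hc]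
  simp [qFact_ne_zero hq]

/-- The factor `qFact q k` from the column split cancels the `m_0` part of the normalisation. The
multiplicity of the part `1` after deleting `c` columns is `λ'_{c+1} - λ'_{c+2}`, which is exactly
`m_0` for the smaller partition in the variables of `R`. -/
theorem hlColumn_recursion {q : L} (hq : ∀ k, 0 < k → q ^ k ≠ 1) {y : ι → L}
    (lam : YoungDiagram) (c : ℕ) {S : Finset ι} (hy : Set.InjOn y S) (hS : lam.colLen c ≤ S.card) :
    hlColumn q y lam c S = ∑ R ∈ S.powersetCard (lam.colLen c),
      (∏ i ∈ R, ∏ j ∈ S \ R, hlWeight q y i j) * (∏ i ∈ R, y i) *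
        hlColumn q y lam (c + 1) R := by
  rcases le_or_gt (lam.rowLen 0) c with hc | hc
  · rw [colLen_eq_zero_of_rowLen_le lam hc, hlColumn_of_rowLen_le hq lam hc hy]
    simp [hlColumn_of_rowLen_le hq lam (Nat.le_succ_of_le hc) (S := ∅) (by simp)]
  · rw [hlColumn]
    obtain ⟨k, hk⟩ := Nat.exists_eq_add_of_le hS
    rw [hk, orderSum_hlWeight_column (by simpa using hq 1 Nat.one_pos) _ _ _ hk hy
      (fun i hi => by have := (lam.lt_rowLen_iff_lt_colLen i c).2 hi; omega)
      (fun i hi => by have := lam.lt_rowLen_iff_lt_colLen i c; omega), Nat.add_sub_cancel_left,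
      ← Finset.prod_Ioo_mul_eq_prod_Ico hc, ← mul_assoc, Finset.mul_sum]
    refine Finset.sum_congr rfl fun R hR => ?_
    obtain ⟨hRS, hRc⟩ := Finset.mem_powersetCard.1 hR
    rw [hlColumn, hRc, show Finset.Ico (c + 1) (lam.rowLen 0) = Finset.Ioo c (lam.rowLen 0) from by
      ext; simp [Finset.mem_Ico, Finset.mem_Ioo]]
    simp only [Nat.sub_sub]
    have h1 := qFact_ne_zero hq k
    rw [mul_inv, mul_inv, mul_inv]
    field_simp

theorem hlSymmetrization_eq_hlColumn {N : ℕ} (lam : YoungDiagram) (q : L) (f : Fin N ↪ ι)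
    (y : ι → L) :
    hlSymmetrization N lam (fun i => y (f i)) q = hlColumn q y lam 0 (Finset.univ.map f) := by
  rw [hlColumn, hlSymmetrization, hlV_eq, Finset.card_map, Finset.card_univ, Fintype.card_fin,
    ← sum_perm_eq_orderSum]
  rfl

end HallLittlewoodColumn

/-! ### Behaviour when one variable is zero. -/

section ZeroVariable

variable {ι L : Type*} [DecidableEq ι] [Field L]

/-- In the recursion, sets containing `i₀` are killed by `∏ y_i`; for the others the weight of `y_i`
against `0` is `1`. -/
theorem hlColumn_insert_of_eq_zero {q : L} (hq : ∀ k, 0 < k → q ^ k ≠ 1) {y : ι → L}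
    (lam : YoungDiagram) (c : ℕ) {S : Finset ι} {i₀ : ι} (hi₀ : i₀ ∉ S) (h0 : y i₀ = 0)
    (hy : Set.InjOn y (insert i₀ S : Finset ι)) (hS : lam.colLen c ≤ S.card) :
    hlColumn q y lam c (insert i₀ S) = hlColumn q y lam c S := by
  rw [hlColumn_recursion hq lam c hy (by rw [Finset.card_insert_of_notMem hi₀]; omega),
    hlColumn_recursion hq lam c (hy.mono (by simp)) hS]
  symm
  apply Finset.sum_subset_zero_on_sdiff
  · exact Finset.powersetCard_mono (Finset.subset_insert _ _)
  · intro R hR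
    simp only [Finset.mem_sdiff, Finset.mem_powersetCard, not_and] at hR
    have hmem : i₀ ∈ R := by
      by_contra hn
      exact hR.2 ((Finset.subset_insert_iff_of_notMem hn).1 hR.1.1) hR.1.2
    rw [Finset.prod_eq_zero hmem h0]
    ring
  · intro R hR
    obtain ⟨hRS, hc⟩ := Finset.mem_powersetCard.1 hR
    have hn : i₀ ∉ R := fun h => hi₀ (hRS h)
    congr 2
    refine Finset.prod_congr rfl fun i hi => ?_
    rw [Finset.insert_sdiff_of_notMem _ hn, Finset.prod_insert (by simp [hi₀])]
    have hne : y i ≠ 0 := fun h => hn (by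
      have := hy (by simp [hRS hi]) (by simp) (h.trans h0.symm)
      rwa [this] at hi)
    simp [hlWeight, h0, hne]

/-- With as many variables as parts, the only set in the recursion is `S` itself, so the product of
all variables divides out. -/
theorem hlColumn_eq_zero {q : L} (hq : ∀ k, 0 < k → q ^ k ≠ 1) {y : ι → L}
    (lam : YoungDiagram) (c : ℕ) {S : Finset ι} {i₀ : ι} (hi₀ : i₀ ∈ S) (h0 : y i₀ = 0)
    (hy : Set.InjOn y S) (hS : S.card = lam.colLen c) :
    hlColumn q y lam c S = 0 := by
  rw [hlColumn_recursion hq lam c hy hS.ge, ← hS, Finset.powersetCard_self, Finset.sum_singleton,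
    Finset.prod_eq_zero (f := y) hi₀ h0]
  ring

end ZeroVariable

/-! ### Evaluating identities in a fraction field at points where the denominators survive. -/

section Specialization

variable {R F K : Type*} [CommRing R] [Field F] [Algebra R F] [Field K]

/-- The element `u` of the fraction field of `R` is regular at the kernel of `φ : R → K`, and
takes the value `k` there. -/
def SpecializesTo (φ : R →+* K) (u : F) (k : K) : Prop :=
  ∃ a b : R, φ b ≠ 0 ∧ u * algebraMap R F b = algebraMap R F a ∧ φ a = k * φ b

namespace SpecializesTo

variable {φ : R →+* K} {u v : F} {k l : K}

theorem of_algebraMap (φ : R →+* K) (p : R) :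
    SpecializesTo φ (algebraMap R F p) (φ p) := ⟨p, 1, by simp, by simp, by simp⟩

theorem eq_of_algebraMap [IsFractionRing R F] {p : R} (h : SpecializesTo φ (algebraMap R F p) k) : φ p = k := by
  obtain ⟨a, b, hb, h1, h2⟩ := h
  rw [← map_mul] at h1
  rw [← IsFractionRing.injective R F h1, map_mul] at h2
  exact mul_right_cancel₀ hb h2

theorem mul (hu : SpecializesTo φ u k) (hv : SpecializesTo φ v l) :
    SpecializesTo φ (u * v) (k * l) := by
  obtain ⟨a, b, hb, h1, h2⟩ := hu
  obtain ⟨c, d, hd, h3, h4⟩ := hv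
  refine ⟨a * c, b * d, by simp [hb, hd], ?_, ?_⟩
  · rw [map_mul, map_mul, ← h1, ← h3]; ring
  · rw [map_mul, map_mul, h2, h4]; ring

theorem add (hu : SpecializesTo φ u k) (hv : SpecializesTo φ v l) :
    SpecializesTo φ (u + v) (k + l) := by
  obtain ⟨a, b, hb, h1, h2⟩ := hu
  obtain ⟨c, d, hd, h3, h4⟩ := hv
  refine ⟨a * d + c * b, b * d, by simp [hb, hd], ?_, ?_⟩
  · rw [map_add, map_mul, map_mul, map_mul, ← h1, ← h3]; ring
  · rw [map_add, map_mul, map_mul, map_mul, h2, h4]; ring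

theorem inv [IsFractionRing R F] (hu : SpecializesTo φ u k) (hk : k ≠ 0) : SpecializesTo φ u⁻¹ k⁻¹ := by
  obtain ⟨a, b, hb, h1, h2⟩ := hu
  have ha : φ a ≠ 0 := by rw [h2]; exact mul_ne_zero hk hb
  refine ⟨b, a, ha, ?_, by rw [h2, inv_mul_cancel_left₀ hk]⟩
  have hu0 : u ≠ 0 := by
    rintro rfl
    rw [zero_mul, eq_comm, map_eq_zero_iff _ (IsFractionRing.injective R F)] at h1
    exact ha (by rw [h1, map_zero])
  rw [← h1, inv_mul_cancel_left₀ hu0]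

theorem sum {α : Type*} {s : Finset α} {u : α → F} {k : α → K}
    (h : ∀ i ∈ s, SpecializesTo φ (u i) (k i)) :
    SpecializesTo φ (∑ i ∈ s, u i) (∑ i ∈ s, k i) := by
  induction s using Finset.cons_induction with
  | empty => simpa using of_algebraMap (F := F) φ 0
  | cons a s ha ih =>
    rw [Finset.sum_cons, Finset.sum_cons]
    exact (h a (Finset.mem_cons_self _ _)).add (ih fun i hi => h i (Finset.mem_cons_of_mem hi))

theorem prod {α : Type*} {s : Finset α} {u : α → F} {k : α → K}
    (h : ∀ i ∈ s, SpecializesTo φ (u i) (k i)) :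
    SpecializesTo φ (∏ i ∈ s, u i) (∏ i ∈ s, k i) := by
  induction s using Finset.cons_induction with
  | empty => simpa using of_algebraMap (F := F) φ 1
  | cons a s ha ih =>
    rw [Finset.prod_cons, Finset.prod_cons]
    exact (h a (Finset.mem_cons_self _ _)).mul (ih fun i hi => h i (Finset.mem_cons_of_mem hi))

end SpecializesTo

end Specialization

/-! ### Evaluation of Hall–Littlewood polynomials, and stability in the number of variables. -/

section QField

theorem qVar_pow_ne_one {k : ℕ} (hk : 0 < k) : qVar ^ k ≠ 1 := by
  intro h
  have h1 : (Polynomial.X ^ k : Polynomial ℚ) = 1 := by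
    apply RatFunc.algebraMap_injective ℚ
    rw [map_pow, RatFunc.algebraMap_X, map_one]
    exact h
  have h2 := congrArg Polynomial.natDegree h1
  simp at h2
  omega

theorem qVar_ne_zero : qVar ≠ 0 := RatFunc.X_ne_zero

variable {K : Type*} [Field K] [Algebra QField K]

variable (K) in
theorem algebraMap_qVar_pow_ne_one (k : ℕ) (hk : 0 < k) : (algebraMap QField K qVar) ^ k ≠ 1 := by
  rw [← map_pow, Ne, map_eq_one_iff _ (algebraMap QField K).injective]
  exact qVar_pow_ne_one hk

theorem map_qFact {L L' : Type*} [Field L] [Field L'] (ψ : L →+* L') (q : L) (k : ℕ) :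
    ψ (qFact q k) = qFact (ψ q) k := by
  simp [qFact, qPoch_natCast]

theorem map_hlV {L L' : Type*} [Field L] [Field L'] (ψ : L →+* L') (N : ℕ) (lam : YoungDiagram)
    (q : L) : ψ (hlV N lam q) = hlV N lam (ψ q) := by
  simp [hlV_eq, map_qFact]

theorem RatFun.q_eq (n : ℕ) : RatFun.q n = algebraMap QField (RatFun n) qVar := by
  rw [RatFun.q, ← MvPolynomial.algebraMap_eq, ← IsScalarTower.algebraMap_apply]

theorem RatFun.x_injective (n : ℕ) : Function.Injective (RatFun.x : Fin n → RatFun n) :=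
  fun _ _ h => MvPolynomial.X_injective (IsFractionRing.injective _ _ h)

theorem RatFun.x_ne_zero {n : ℕ} (i : Fin n) : RatFun.x i ≠ 0 := by
  rw [RatFun.x, Ne, map_eq_zero_iff _ (IsFractionRing.injective _ _)]
  exact MvPolynomial.X_ne_zero i

/-- Evaluating a polynomial form of the Hall–Littlewood polynomial at distinct elements. -/
theorem aeval_eq_hlSymmetrization {N : ℕ} {lam : YoungDiagram} {p : MvPolynomial (Fin N) QField}
    (hp : algebraMap _ (RatFun N) p = hlSymmetrization N lam RatFun.x (RatFun.q N))
    {y : Fin N → K} (hy : Function.Injective y) :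
    MvPolynomial.aeval y p = hlSymmetrization N lam y (algebraMap QField K qVar) := by
  set φ : MvPolynomial (Fin N) QField →+* K := (MvPolynomial.aeval y).toRingHom with hφ
  have hC : ∀ c : QField, φ (MvPolynomial.C c) = algebraMap QField K c :=
    fun c => MvPolynomial.aeval_C y c
  have hx : ∀ i, φ (MvPolynomial.X i) = y i := fun i => MvPolynomial.aeval_X y i
  -- The formula is built by ring operations and two kinds of inverses: `v_λ`, nonzero as `q` is not
  -- a root of unity, and `y_i - y_j`, nonzero by injectivity.
  suffices h : SpecializesTo φ (hlSymmetrization N lam RatFun.x (RatFun.q N))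
      (hlSymmetrization N lam y (algebraMap QField K qVar)) by
    rw [← hp] at h
    exact h.eq_of_algebraMap
  refine .mul (.inv ?_ (hlV_ne_zero (algebraMap_qVar_pow_ne_one K) _ _))
    (.sum fun w _ => .mul ?_ ?_)
  · have h := SpecializesTo.of_algebraMap (F := RatFun N) φ (MvPolynomial.C (hlV N lam qVar))
    rw [hC, map_hlV, ← MvPolynomial.algebraMap_eq, ← IsScalarTower.algebraMap_apply, map_hlV] at h
    rwa [RatFun.q_eq]
  · refine .prod fun i _ => ?_
    have h := SpecializesTo.of_algebraMap (F := RatFun N) φ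
      (MvPolynomial.X (w i) ^ lam.rowLen i)
    rwa [map_pow, map_pow, hx] at h
  · refine .prod fun i _ => .prod fun j hj => ?_
    rw [div_eq_mul_inv, div_eq_mul_inv]
    refine .mul ?_ (.inv ?_ ?_)
    · have h := SpecializesTo.of_algebraMap (F := RatFun N) φ
        (MvPolynomial.X (w i) - MvPolynomial.C qVar * MvPolynomial.X (w j))
      simp only [map_sub, map_mul, hx, hC] at h
      exact h
    · have h := SpecializesTo.of_algebraMap (F := RatFun N) φ
        (MvPolynomial.X (w i) - MvPolynomial.X (w j))
      simp only [map_sub, hx] at h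
      exact h
    · rw [sub_ne_zero]
      exact fun h => (Finset.mem_Ioi.1 hj).ne (w.injective (hy h))

theorem aeval_eq_hlColumn {N : ℕ} {lam : YoungDiagram} {p : MvPolynomial (Fin N) QField}
    (hp : algebraMap _ (RatFun N) p = hlSymmetrization N lam RatFun.x (RatFun.q N))
    {ι : Type*} [DecidableEq ι] (f : Fin N ↪ ι) {y : ι → K}
    (hy : Set.InjOn y (Finset.univ.map f : Finset ι)) :
    MvPolynomial.aeval (fun i => y (f i)) p =
      hlColumn (algebraMap QField K qVar) y lam 0 (Finset.univ.map f) := by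
  rw [aeval_eq_hlSymmetrization hp, hlSymmetrization_eq_hlColumn]
  exact fun i j h => f.injective (hy (by simp) (by simp) h)

/-- The variables `x_1, …, x_N` followed by zero. -/
noncomputable def RatFun.snocZero (N : ℕ) : Fin (N + 1) → RatFun N :=
  Fin.snoc RatFun.x 0

/-- Distinctness makes the symmetrisation formula usable at the point `(x_1, …, x_N, 0)`. -/
theorem RatFun.snocZero_injective (N : ℕ) : Function.Injective (RatFun.snocZero N) :=
  Fin.snoc_injective_of_injective (RatFun.x_injective N) (by
    rintro ⟨i, hi⟩
    exact RatFun.x_ne_zero i hi)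

theorem algebraMap_aeval_snoc {N : ℕ} (p : MvPolynomial (Fin (N + 1)) QField) :
    algebraMap _ (RatFun N) (MvPolynomial.aeval
      (Fin.snoc MvPolynomial.X 0 : Fin (N + 1) → MvPolynomial (Fin N) QField) p) =
    MvPolynomial.aeval (RatFun.snocZero N) p := by
  rw [← MvPolynomial.aeval_algebraMap_apply]
  congr 2
  funext i
  refine Fin.lastCases ?_ (fun j => ?_) i <;> simp [RatFun.snocZero, RatFun.x]

/-- Setting the last variable to zero in a Hall–Littlewood polynomial. -/
theorem aeval_snoc_eq {N : ℕ} {lam : YoungDiagram} (hN : lam.colLen 0 ≤ N)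
    {p : MvPolynomial (Fin (N + 1)) QField}
    (hp : algebraMap _ (RatFun (N + 1)) p =
      hlSymmetrization (N + 1) lam RatFun.x (RatFun.q (N + 1))) :
    algebraMap _ (RatFun N) (MvPolynomial.aeval
      (Fin.snoc MvPolynomial.X 0 : Fin (N + 1) → MvPolynomial (Fin N) QField) p) =
    hlSymmetrization N lam RatFun.x (RatFun.q N) := by
  have h1 := aeval_eq_hlColumn hp (Function.Embedding.refl _) (RatFun.snocZero_injective N).injOn
  have h2 := hlSymmetrization_eq_hlColumn lam (algebraMap QField (RatFun N) qVar)
    (Fin.castSuccEmb (n := N)) (RatFun.snocZero N)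
  have h3 : (Finset.univ.map (Function.Embedding.refl (Fin (N + 1)))) =
      insert (Fin.last N) (Finset.univ.map (Fin.castSuccEmb (n := N))) := by
    ext i
    refine Fin.lastCases ?_ (fun j => ?_) i <;> simp
  rw [h3, hlColumn_insert_of_eq_zero (algebraMap_qVar_pow_ne_one _) lam 0 (by simp)
    (by simp [RatFun.snocZero]) (RatFun.snocZero_injective N).injOn (by simpa using hN), ← h2] at h1
  rw [algebraMap_aeval_snoc, RatFun.q_eq]
  refine h1.trans ?_
  congr 1
  funext i
  simp [RatFun.snocZero]

theorem aeval_snoc_eq_zero {N : ℕ} {lam : YoungDiagram} (hN : lam.colLen 0 = N + 1)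
    {p : MvPolynomial (Fin (N + 1)) QField}
    (hp : algebraMap _ (RatFun (N + 1)) p =
      hlSymmetrization (N + 1) lam RatFun.x (RatFun.q (N + 1))) :
    MvPolynomial.aeval
      (Fin.snoc MvPolynomial.X 0 : Fin (N + 1) → MvPolynomial (Fin N) QField) p = 0 := by
  apply IsFractionRing.injective _ (RatFun N)
  have h1 := aeval_eq_hlColumn hp (Function.Embedding.refl _) (RatFun.snocZero_injective N).injOn
  rw [hlColumn_eq_zero (i₀ := Fin.last N) (algebraMap_qVar_pow_ne_one _) lam 0 (by simp)
    (by simp [RatFun.snocZero]) (RatFun.snocZero_injective N).injOn (by simp [hN])] at h1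
  rw [algebraMap_aeval_snoc, map_zero]
  exact h1

theorem aeval_snoc_inVars (N : ℕ) (F : SymmFun) :
    MvPolynomial.aeval (Fin.snoc MvPolynomial.X 0 : Fin (N + 1) → MvPolynomial (Fin N) QField)
      (SymmFun.inVars (N + 1) F) = SymmFun.inVars N F := by
  have h : (MvPolynomial.aeval (Fin.snoc MvPolynomial.X 0 :
      Fin (N + 1) → MvPolynomial (Fin N) QField)).comp (SymmFun.inVars (N + 1)) =
      SymmFun.inVars N := by
    refine MvPolynomial.algHom_ext fun r => ?_
    simp [SymmFun.inVars, MvPolynomial.psum, Fin.sum_univ_castSucc]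
  exact DFunLike.congr_fun h F

end QField

/-! ### Alternating polynomials are divisible by the Vandermonde product. -/

section Alternating

open MvPolynomial

variable {k : Type*} [Field k] {N : ℕ}

/-- The product `∏_{i < j} (x_i - x_j)`. -/
noncomputable def vandermondeProd (k : Type*) [Field k] (N : ℕ) : MvPolynomial (Fin N) k :=
  ∏ i, ∏ j ∈ Finset.Ioi i, (X i - X j)

theorem rename_vandermondeProd (w : Equiv.Perm (Fin N)) :
    rename w (vandermondeProd k N) = (Equiv.Perm.sign w : ℤ) * vandermondeProd k N := by
  have h : ∀ v : Fin N → MvPolynomial (Fin N) k, ∏ i, ∏ j ∈ Finset.Ioi i, (v i - v j) =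
      (Matrix.vandermonde fun i => -v i).det := by
    intro v
    rw [Matrix.det_vandermonde]
    exact Finset.prod_congr rfl fun i _ => Finset.prod_congr rfl fun j _ => by ring
  have h1 := Matrix.det_permute w (Matrix.vandermonde fun i => -(X i : MvPolynomial (Fin N) k))
  rw [← h X] at h1
  rw [vandermondeProd, ← h1]
  simp only [map_prod, map_sub, rename_X]
  rw [h fun i => X (w i)]
  rfl

theorem irreducible_X_sub_X {i j : Fin N} (hij : i ≠ j) :
    Irreducible (X i - X j : MvPolynomial (Fin N) k) := by
  refine irreducible_of_totalDegree_eq_one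
    (((isHomogeneous_X k i).sub (isHomogeneous_X k j)).totalDegree
      (sub_ne_zero.2 fun h => hij (X_injective h))) fun x hx => ?_
  have h := hx (Finsupp.single i 1)
  have hne : Finsupp.single j 1 ≠ Finsupp.single i 1 := fun h =>
    hij (Finsupp.single_left_injective one_ne_zero h).symm
  rw [coeff_sub, coeff_X, coeff_X, if_neg hne, sub_zero, if_pos rfl] at h
  exact isUnit_of_dvd_one h

/-- Modulo `x_i - x_j`, replacing `x_j` by `x_i` changes nothing. -/
theorem X_sub_X_dvd_sub_aeval_update (i j : Fin N) (f : MvPolynomial (Fin N) k) :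
    X i - X j ∣ f - aeval (Function.update X j (X i)) f := by
  rw [← Ideal.mem_span_singleton, ← Ideal.Quotient.eq]
  have h : (Ideal.Quotient.mkₐ k (Ideal.span {(X i - X j : MvPolynomial (Fin N) k)})) =
      (Ideal.Quotient.mkₐ k (Ideal.span {(X i - X j : MvPolynomial (Fin N) k)})).comp
        (aeval (Function.update X j (X i))) := by
    refine algHom_ext fun m => ?_
    by_cases hm : m = j
    · subst hm
      simp only [AlgHom.comp_apply, aeval_X, Function.update_self, Ideal.Quotient.mkₐ_eq_mk]
      rw [eq_comm, Ideal.Quotient.eq]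
      exact Ideal.mem_span_singleton_self _
    · simp [Function.update_of_ne hm]
  exact DFunLike.congr_fun h f

/-- The factors `x_i - x_j` are irreducible and pairwise coprime, so divisibility can be tested one
factor at a time. Setting `x_j = x_i` turns antisymmetry into `f = -f`, and `2 ≠ 0`. -/
theorem vandermondeProd_dvd [CharZero k] {f : MvPolynomial (Fin N) k}
    (hf : ∀ i j, i ≠ j → rename (Equiv.swap i j) f = -f) : vandermondeProd k N ∣ f := by
  rw [vandermondeProd, Finset.prod_sigma']
  apply Finset.prod_dvd_of_isRelPrime
  · rintro ⟨i, j⟩ hij ⟨i', j'⟩ hij' hne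
    simp only [Finset.coe_sigma, Set.mem_sigma_iff, Finset.coe_univ, Set.mem_univ, true_and,
      Finset.coe_Ioi, Set.mem_Ioi] at hij hij'
    refine ((irreducible_X_sub_X hij.ne).isRelPrime_iff_not_dvd).2 fun hd => hne ?_
    obtain ⟨g, hg⟩ := hd
    have h1 := congrArg (aeval (Function.update X j (X i) : Fin N → MvPolynomial (Fin N) k)) hg
    simp only [map_sub, map_mul, aeval_X, Function.update_self, Function.update_of_ne hij.ne,
      sub_self, zero_mul] at h1
    have h2 := sub_eq_zero.1 h1
    have hX := X_injective (σ := Fin N) (R := k)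
    by_cases e1 : i' = j
    · subst e1
      rw [Function.update_self, Function.update_of_ne hij'.ne'] at h2
      exact absurd (hX h2) (hij.trans hij').ne
    · rw [Function.update_of_ne e1] at h2
      by_cases e2 : j' = j
      · subst e2
        rw [Function.update_self] at h2
        rw [hX h2]
      · rw [Function.update_of_ne e2] at h2
        exact absurd (hX h2) hij'.ne
  · rintro ⟨i, j⟩ hij
    simp only [Finset.mem_sigma, Finset.mem_univ, true_and, Finset.mem_Ioi] at hij
    have h := X_sub_X_dvd_sub_aeval_update i j f
    suffices h0 : aeval (Function.update X j (X i)) f = (0 : MvPolynomial (Fin N) k) by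
      rwa [h0, sub_zero] at h
    have h1 : (aeval (Function.update X j (X i) : Fin N → MvPolynomial (Fin N) k)).comp
        (rename (R := k) (Equiv.swap i j)) = aeval (Function.update X j (X i)) := by
      refine algHom_ext fun m => ?_
      simp only [AlgHom.comp_apply, rename_X, aeval_X]
      by_cases e1 : m = i
      · subst e1; simp [Function.update_of_ne hij.ne]
      · by_cases e2 : m = j
        · subst e2; simp [Function.update_of_ne hij.ne]
        · rw [Equiv.swap_apply_of_ne_of_ne e1 e2]
    have h2 := DFunLike.congr_fun h1 f
    rw [AlgHom.comp_apply, hf i j hij.ne, map_neg] at h2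
    have h3 : (2 : MvPolynomial (Fin N) k) * aeval (Function.update X j (X i)) f = 0 := by
      rw [two_mul]
      nth_rewrite 1 [← h2]
      exact neg_add_cancel _
    have h4 : (2 : MvPolynomial (Fin N) k) ≠ 0 := by
      rw [← map_ofNat (C : k →+* MvPolynomial (Fin N) k)]
      exact (map_ne_zero_iff _ (C_injective _ _)).2 two_ne_zero
    exact (mul_eq_zero.1 h3).resolve_left h4

/-- The degree `d + c` component of `p * u` is `p_d * u`, so `p_d` can replace `p`. This makes the
quotient by the Vandermonde product homogeneous. -/
theorem exists_isHomogeneous_of_mul_isHomogeneous {σ : Type*} {p u : MvPolynomial σ k} {c d : ℕ}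
    (hu : u.IsHomogeneous c) (hpu : (p * u).IsHomogeneous (d + c)) :
    ∃ p' : MvPolynomial σ k, p'.IsHomogeneous d ∧ p' * u = p * u := by
  refine ⟨homogeneousComponent d p, homogeneousComponent_isHomogeneous d p, ?_⟩
  have h1 := homogeneousComponent_of_mem ((mem_homogeneousSubmodule _ _).2 hpu) (m := d + c)
  rw [if_pos rfl] at h1
  rw [← h1]
  nth_rewrite 2 [← sum_homogeneousComponent p]
  rw [Finset.sum_mul, map_sum]
  have h2 : ∀ i, homogeneousComponent (d + c) (homogeneousComponent i p * u) =
      if i = d then homogeneousComponent d p * u else 0 := by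
    intro i
    rw [homogeneousComponent_of_mem ((mem_homogeneousSubmodule _ _).2
      ((homogeneousComponent_isHomogeneous i p).mul hu))]
    by_cases h : i = d
    · simp [h]
    · rw [if_neg h, if_neg (by omega)]
  simp only [h2, Finset.sum_ite_eq', Finset.mem_range]
  split_ifs with h
  · rfl
  · rw [homogeneousComponent_eq_zero _ _ (by omega), zero_mul]

end Alternating

/-! ### The symmetrisation is a homogeneous symmetric polynomial. -/

section Polynomiality

open MvPolynomial

variable {N : ℕ}

theorem hlSymmetrization_comp_perm {L : Type*} [Field L] (lam : YoungDiagram) (y : Fin N → L)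
    (q : L) (σ : Equiv.Perm (Fin N)) :
    hlSymmetrization N lam (fun i => y (σ i)) q = hlSymmetrization N lam y q := by
  rw [hlSymmetrization, hlSymmetrization]
  congr 1
  exact Equiv.sum_comp (Equiv.mulLeft σ) fun w : Equiv.Perm (Fin N) => (∏ i : Fin N, y (w i) ^ lam.rowLen i) *
    ∏ i, ∏ j ∈ Finset.Ioi i, (y (w i) - q * y (w j)) / (y (w i) - y (w j))

/-- `x^lam ∏_{i < j} (x_i - q x_j)`. -/
noncomputable def hlNumerator (N : ℕ) (lam : YoungDiagram) : MvPolynomial (Fin N) QField :=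
  (∏ i : Fin N, X i ^ lam.rowLen i) * ∏ i, ∏ j ∈ Finset.Ioi i, (X i - C qVar * X j)

/-- Over the common denominator `∏_{i<j} (x_i - x_j)` the numerator is an antisymmetrisation, since
permuting the denominator by `w` multiplies it by the sign of `w`; hence the division is exact. -/
theorem exists_algebraMap_eq_hlSymmetrization (lam : YoungDiagram) (hN : lam.colLen 0 ≤ N) :
    ∃ p : MvPolynomial (Fin N) QField,
      algebraMap _ (RatFun N) p = hlSymmetrization N lam RatFun.x (RatFun.q N) ∧
      p.IsHomogeneous (∑ i ∈ Finset.range (lam.colLen 0), lam.rowLen i) := by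
  have hsum : ∑ i ∈ Finset.range (lam.colLen 0), lam.rowLen i = ∑ i : Fin N, lam.rowLen i := by
    rw [Fin.sum_univ_eq_sum_range]
    refine Finset.sum_subset (Finset.range_mono hN) fun i _ hi => ?_
    have := lam.lt_rowLen_iff_lt_colLen i 0
    simp only [Finset.mem_range] at hi
    omega
  let num : MvPolynomial (Fin N) QField :=
    ∑ w : Equiv.Perm (Fin N), (Equiv.Perm.sign w : ℤ) * rename w (hlNumerator N lam)
  have hdvd : vandermondeProd QField N ∣ num := by
    refine vandermondeProd_dvd fun i j hij => ?_
    simp only [num, map_sum, map_mul, map_intCast, rename_rename]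
    rw [← Finset.sum_neg_distrib, ← Equiv.sum_comp (Equiv.mulLeft (Equiv.swap i j))]
    refine Finset.sum_congr rfl fun w _ => ?_
    simp only [Equiv.coe_mulLeft, Equiv.Perm.sign_mul, Equiv.Perm.sign_swap hij]
    rw [← Equiv.Perm.coe_mul, ← mul_assoc, Equiv.swap_mul_self, one_mul]
    simp
  obtain ⟨p₀, hp₀⟩ := hdvd
  have hu : (vandermondeProd QField N).IsHomogeneous (∑ i : Fin N, ∑ j ∈ Finset.Ioi i, 1) :=
    .prod _ _ _ fun i _ => .prod _ _ _ fun j _ => (isHomogeneous_X _ i).sub (isHomogeneous_X _ j)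
  have hnum : num.IsHomogeneous ((∑ i : Fin N, lam.rowLen i) +
      ∑ i : Fin N, ∑ j ∈ Finset.Ioi i, 1) := by
    refine .sum _ _ _ fun w _ => ?_
    rw [← map_intCast (C : QField →+* MvPolynomial (Fin N) QField)]
    refine .C_mul (IsHomogeneous.rename_isHomogeneous (.mul ?_ ?_)) _
    · refine .prod _ _ _ fun i _ => ?_
      exact isHomogeneous_X_pow _ _
    · exact .prod _ _ _ fun i _ => .prod _ _ _ fun j _ =>
        (isHomogeneous_X _ i).sub ((isHomogeneous_X _ j).C_mul _)
  rw [hp₀, mul_comm] at hnum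
  obtain ⟨p, hp, hpu⟩ := exists_isHomogeneous_of_mul_isHomogeneous hu hnum
  refine ⟨C (hlV N lam qVar)⁻¹ * p, ?_, by rw [hsum]; exact hp.C_mul _⟩
  rw [mul_comm p₀, ← hp₀] at hpu
  have hV0 : vandermondeProd QField N ≠ 0 := by
    refine Finset.prod_ne_zero_iff.2 fun i _ => Finset.prod_ne_zero_iff.2 fun j hj => ?_
    exact sub_ne_zero.2 fun h => (Finset.mem_Ioi.1 hj).ne (X_injective h)
  have hV0' : algebraMap _ (RatFun N) (vandermondeProd QField N) ≠ 0 := by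
    rwa [Ne, map_eq_zero_iff _ (IsFractionRing.injective _ _)]
  have h3 : algebraMap _ (RatFun N) p =
      algebraMap _ (RatFun N) num / algebraMap _ (RatFun N) (vandermondeProd QField N) := by
    rw [eq_div_iff hV0', ← map_mul, hpu]
  rw [map_mul, h3, hlSymmetrization, RatFun.q_eq, ← map_hlV, ← map_inv₀,
    ← MvPolynomial.algebraMap_eq, ← IsScalarTower.algebraMap_apply]
  congr 1
  rw [map_sum, Finset.sum_div]
  refine Finset.sum_congr rfl fun w _ => ?_
  have h4 := congrArg (algebraMap _ (RatFun N)) (rename_vandermondeProd (k := QField) w)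
  have hs : ((Equiv.Perm.sign w : ℤ) : RatFun N) ≠ 0 := by
    rcases Int.units_eq_one_or (Equiv.Perm.sign w) with h | h <;> simp [h]
  have hs2 : ((Equiv.Perm.sign w : ℤ) : RatFun N) * ((Equiv.Perm.sign w : ℤ) : RatFun N) = 1 := by
    rcases Int.units_eq_one_or (Equiv.Perm.sign w) with h | h <;> simp [h]
  rw [map_mul, map_intCast] at h4
  have h5 : algebraMap _ (RatFun N) (vandermondeProd QField N) = ((Equiv.Perm.sign w : ℤ) : RatFun N)
      * algebraMap _ (RatFun N) (rename w (vandermondeProd QField N)) := by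
    rw [h4, ← mul_assoc, hs2, one_mul]
  rw [h5, map_mul, map_intCast, mul_div_mul_left _ _ hs]
  simp only [hlNumerator, vandermondeProd, map_mul, map_prod, map_sub, map_pow, rename_X, rename_C,
    Finset.prod_div_distrib, ← RatFun.q_eq]
  rw [mul_div_assoc]
  rfl

theorem isSymmetric_of_algebraMap_eq_hlSymmetrization {lam : YoungDiagram}
    {p : MvPolynomial (Fin N) QField}
    (hp : algebraMap _ (RatFun N) p = hlSymmetrization N lam RatFun.x (RatFun.q N)) :
    p.IsSymmetric := by
  intro σ
  apply IsFractionRing.injective _ (RatFun N)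
  rw [hp, ← hlSymmetrization_comp_perm lam RatFun.x (RatFun.q N) σ, RatFun.q_eq,
    ← aeval_eq_hlSymmetrization (y := fun i => RatFun.x (σ i)) hp
      ((RatFun.x_injective N).comp σ.injective)]
  have h : (IsScalarTower.toAlgHom QField (MvPolynomial (Fin N) QField) (RatFun N)).comp
      (rename σ) = aeval fun i => RatFun.x (σ i) := by
    refine algHom_ext fun m => ?_
    simp [RatFun.x]
  exact DFunLike.congr_fun h p

end Polynomiality

/-! ### Existence of the Hall–Littlewood symmetric function. -/

section Existence

open MvPolynomial

theorem SymmFun.inVars_X (N : ℕ) (r : ℕ+) :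
    SymmFun.inVars N (X r) = psum (Fin N) QField (r : ℕ) := aeval_X _ r

/-- Newton's identities, solved for `e_k` by dividing by `k` in characteristic zero. -/
theorem esymm_mem_range_inVars (N k : ℕ) :
    esymm (Fin N) QField k ∈ (SymmFun.inVars N).range := by
  induction k using Nat.strong_induction_on with
  | _ k ih =>
    rcases Nat.eq_zero_or_pos k with rfl | hk
    · rw [esymm_zero]
      exact one_mem _
    · have hk' : ((k : ℕ) : QField) ≠ 0 := by exact_mod_cast hk.ne'
      have h := mul_esymm_eq_sum (Fin N) QField k
      have h2 : esymm (Fin N) QField k = C ((k : QField)⁻¹) *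
          ((k : MvPolynomial (Fin N) QField) * esymm (Fin N) QField k) := by
        rw [← map_natCast (C : QField →+* MvPolynomial (Fin N) QField), ← mul_assoc, ← map_mul,
          inv_mul_cancel₀ hk', map_one, one_mul]
      rw [h2, h]
      refine mul_mem (Subalgebra.algebraMap_mem _ _) (mul_mem (pow_mem (neg_mem (one_mem _)) _)
        (sum_mem fun a ha => ?_))
      obtain ⟨ha1, ha2⟩ := Finset.mem_filter.1 ha
      have ha3 : a.1 + a.2 = k := Finset.HasAntidiagonal.mem_antidiagonal.1 ha1
      refine mul_mem (mul_mem (pow_mem (neg_mem (one_mem _)) _) (ih _ ha2)) ?_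
      exact ⟨X ⟨a.2, by omega⟩, SymmFun.inVars_X N _⟩

theorem exists_inVars_eq_of_isSymmetric {N : ℕ} {p : MvPolynomial (Fin N) QField}
    (hp : p.IsSymmetric) : ∃ F : SymmFun, SymmFun.inVars N F = p := by
  obtain ⟨G, hG⟩ := esymmAlgHom_surjective (σ := Fin N) QField (Fintype.card_fin N).le ⟨p, hp⟩
  have h := congrArg Subtype.val hG
  rw [esymmAlgHom_apply] at h
  change _ = p at h
  choose e he using esymm_mem_range_inVars N
  refine ⟨aeval (fun i : Fin N => e (i + 1)) G, ?_⟩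
  rw [← h, ← AlgHom.comp_apply, comp_aeval]
  congr 2
  funext i
  exact he _

theorem inVars_weightedHomogeneousComponent (N d : ℕ) (F : SymmFun) :
    SymmFun.inVars N (weightedHomogeneousComponent (fun r : ℕ+ => (r : ℕ)) d F) =
      homogeneousComponent d (SymmFun.inVars N F) := by
  induction F using MvPolynomial.induction_on' with
  | monomial m c =>
    have h1 : (SymmFun.inVars N (monomial m c)).IsHomogeneous
        (Finsupp.weight (fun r : ℕ+ => (r : ℕ)) m) := by
      rw [SymmFun.inVars, aeval_monomial, Finsupp.weight_apply]
      refine IsHomogeneous.C_mul (.prod _ _ _ fun r _ => ?_) _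
      change IsHomogeneous (psum (Fin N) QField r ^ m r) (m r * r)
      rw [mul_comm]
      refine .pow (.sum _ _ _ fun i _ => ?_) _
      exact isHomogeneous_X_pow _ _
    rw [homogeneousComponent_of_mem ((mem_homogeneousSubmodule _ _).2 h1),
      weightedHomogeneousComponent_of_mem ((mem_weightedHomogeneousSubmodule _ _ _ _).2
        (isWeightedHomogeneous_monomial _ m c rfl))]
    split_ifs <;> simp
  | add p q hp hq => simp only [map_add, hp, hq]

theorem X_last_dvd_sub {N : ℕ} (h : MvPolynomial (Fin (N + 1)) QField) :
    X (Fin.last N) ∣ h - rename Fin.castSucc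
      (aeval (Fin.snoc X 0 : Fin (N + 1) → MvPolynomial (Fin N) QField) h) := by
  rw [← Ideal.mem_span_singleton, ← Ideal.Quotient.eq]
  have h1 : (Ideal.Quotient.mkₐ QField
        (Ideal.span {(X (Fin.last N) : MvPolynomial (Fin (N + 1)) QField)})) =
      (Ideal.Quotient.mkₐ QField
        (Ideal.span {(X (Fin.last N) : MvPolynomial (Fin (N + 1)) QField)})).comp
        ((rename Fin.castSucc).comp
          (aeval (Fin.snoc X 0 : Fin (N + 1) → MvPolynomial (Fin N) QField))) := by
    refine algHom_ext fun m => Fin.lastCases ?_ (fun j => ?_) m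
    · simp only [AlgHom.comp_apply, aeval_X, Fin.snoc_last, map_zero, Ideal.Quotient.mkₐ_eq_mk]
      exact Ideal.Quotient.eq_zero_iff_mem.2 (Ideal.mem_span_singleton_self _)
    · simp
  exact DFunLike.congr_fun h1 h

/-- Divisibility by the last variable spreads to every variable by symmetry, so each monomial would
have degree at least `N + 1 > d`. -/
theorem eq_zero_of_aeval_snoc_eq_zero {N d : ℕ} (hd : d ≤ N)
    {h : MvPolynomial (Fin (N + 1)) QField} (hs : h.IsSymmetric) (hh : h.IsHomogeneous d)
    (h0 : aeval (Fin.snoc X 0 : Fin (N + 1) → MvPolynomial (Fin N) QField) h = 0) : h = 0 := by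
  have h1 := X_last_dvd_sub h
  rw [h0, map_zero, sub_zero] at h1
  have h2 : ∀ i, X i ∣ h := by
    intro i
    have := map_dvd (rename (R := QField) (Equiv.swap (Fin.last N) i)) h1
    rwa [hs, rename_X, Equiv.swap_apply_left] at this
  ext m
  rw [coeff_zero]
  by_contra hm
  have h3 : m.degree = d := by
    by_contra hne
    exact hm (hh.coeff_eq_zero hne)
  have h4 : ∀ i, 1 ≤ m i := by
    intro i
    by_contra hi
    obtain ⟨g, hg⟩ := h2 i
    rw [hg, coeff_X_mul', if_neg (by simp; omega)] at hm
    exact hm rfl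
  have h5 : ∑ _i : Fin (N + 1), 1 ≤ ∑ i, m i := Finset.sum_le_sum fun i _ => h4 i
  rw [Finsupp.degree_eq_sum] at h3
  simp at h5
  omega

theorem exists_isHallLittlewood (lam : YoungDiagram) : ∃ F, IsHallLittlewood lam F := by
  set d := ∑ i ∈ Finset.range (lam.colLen 0), lam.rowLen i with hd
  -- Large enough for both `l(λ) ≤ N₀` and `d ≤ N₀`: below `N₀` variables are set to zero, above it
  -- a degree `d` symmetric polynomial is determined by its restriction to one variable fewer.
  set N₀ := lam.colLen 0 + d with hN₀
  obtain ⟨p, hp, hph⟩ := exists_algebraMap_eq_hlSymmetrization (N := N₀) lam (Nat.le_add_right _ _)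
  obtain ⟨F₀, hF₀⟩ := exists_inVars_eq_of_isSymmetric
    (isSymmetric_of_algebraMap_eq_hlSymmetrization hp)
  set F := weightedHomogeneousComponent (fun r : ℕ+ => (r : ℕ)) d F₀ with hF
  have hFN : ∀ N, (SymmFun.inVars N F).IsHomogeneous d := fun N => by
    rw [hF, inVars_weightedHomogeneousComponent]
    exact homogeneousComponent_isHomogeneous _ _
  have base : algebraMap _ (RatFun N₀) (SymmFun.inVars N₀ F) =
      hlSymmetrization N₀ lam RatFun.x (RatFun.q N₀) := by
    rw [hF, inVars_weightedHomogeneousComponent, hF₀, homogeneousComponent_eq_self hph, hp]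
  refine ⟨F, fun N hN => ?_⟩
  rcases le_total N N₀ with hle | hle
  · induction hle using Nat.decreasingInduction with
    | self => exact base
    | of_succ m hm ih =>
      have := aeval_snoc_eq hN (ih (by omega))
      rwa [aeval_snoc_inVars] at this
  · induction N, hle using Nat.le_induction with
    | base => exact base
    | succ N hle ih =>
      obtain ⟨p', hp', hph'⟩ := exists_algebraMap_eq_hlSymmetrization (N := N + 1) lam (by omega)
      have hsymm : (SymmFun.inVars (N + 1) F).IsSymmetric := by
        intro σ
        have : (rename (R := QField) σ).comp (SymmFun.inVars (N + 1)) = SymmFun.inVars (N + 1) :=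
          algHom_ext fun r => by
            rw [AlgHom.comp_apply, SymmFun.inVars_X]
            exact psum_isSymmetric _ _ _ σ
        exact DFunLike.congr_fun this F
      have h0 : SymmFun.inVars (N + 1) F - p' = 0 := by
        refine eq_zero_of_aeval_snoc_eq_zero (d := d) (by omega)
          (hsymm.sub (isSymmetric_of_algebraMap_eq_hlSymmetrization hp'))
          ((hFN _).sub hph') ?_
        rw [map_sub, aeval_snoc_inVars, sub_eq_zero]
        apply IsFractionRing.injective _ (RatFun N)
        rw [ih (by omega), aeval_snoc_eq (by omega) hp']
      rw [sub_eq_zero.1 h0, hp']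

theorem isHallLittlewood_hallLittlewoodP (lam : YoungDiagram) :
    IsHallLittlewood lam (hallLittlewoodP lam) :=
  Classical.epsilon_spec (exists_isHallLittlewood lam)

/-- In `l(λ) - 1` variables the polynomial is zero, and evaluating it at the origin gives the
constant term. Needed for `n = 0`. -/
theorem constantCoeff_eq_zero_of_isHallLittlewood {lam : YoungDiagram} (hlam : lam.colLen 0 ≠ 0)
    {F : SymmFun} (hF : IsHallLittlewood lam F) : constantCoeff F = 0 := by
  obtain ⟨N, hN⟩ := Nat.exists_eq_succ_of_ne_zero hlam
  have h := aeval_snoc_eq_zero hN (hF (N + 1) hN.le)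
  rw [aeval_snoc_inVars] at h
  have h1 : (aeval (fun _ => 0 : Fin N → QField)).comp (SymmFun.inVars N) =
      aeval (fun _ => 0 : ℕ+ → QField) := by
    refine algHom_ext fun r => ?_
    simp [SymmFun.inVars_X, psum, r.pos.ne']
  have h2 := DFunLike.congr_fun h1 F
  rw [AlgHom.comp_apply, h, map_zero, aeval_zero'] at h2
  simpa using h2.symm

end Existence

/-! ### The points `x_i q^k` and the factorisation of the hypergeometric terms. -/

section Box

variable {n : ℕ} {K : Type*} [Field K]

/-- The set of pairs `(i, k)` with `k < r i`. -/
def box (r : Fin n → ℕ) : Finset (Σ _ : Fin n, ℕ) :=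
  Finset.univ.sigma fun i => Finset.range (r i)

theorem mem_box {r : Fin n → ℕ} {t : Σ _ : Fin n, ℕ} : t ∈ box r ↔ t.2 < r t.1 := by
  simp [box]

theorem card_box (r : Fin n → ℕ) : (box r).card = ∑ i, r i := by
  simp [box]

theorem box_subset_box {r s : Fin n → ℕ} : box s ⊆ box r ↔ s ≤ r := by
  constructor
  · intro h i
    by_contra hi
    have := @h ⟨i, r i⟩ (mem_box.2 (not_le.1 hi))
    exact lt_irrefl _ (mem_box.1 this)
  · exact fun h t ht => mem_box.2 ((mem_box.1 ht).trans_le (h _))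

theorem box_injective : Function.Injective (box (n := n)) := fun _ _ h =>
  le_antisymm (box_subset_box.1 h.le) (box_subset_box.1 h.ge)

theorem box_sdiff_box (r s : Fin n → ℕ) :
    box r \ box s = Finset.univ.sigma fun i => Finset.Ico (s i) (r i) := by
  ext t
  simp [mem_box, and_comm]

theorem box_zero : box (0 : Fin n → ℕ) = ∅ := by
  ext t
  simp [mem_box]

/-- The element `x_i q ^ k` attached to the pair `(i, k)`. -/
def qPoint (x : Fin n → K) (q : K) (t : Σ _ : Fin n, ℕ) : K := x t.1 * q ^ t.2

theorem prod_box_qPoint (x : Fin n → K) (q : K) (r : Fin n → ℕ) :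
    ∏ t ∈ box r, qPoint x q t = ∏ i, x i ^ r i * q ^ (r i).choose 2 := by
  rw [box, Finset.prod_sigma]
  refine Finset.prod_congr rfl fun i _ => ?_
  simp only [qPoint]
  induction r i with
  | zero => simp
  | succ k ih =>
    rw [Finset.prod_range_succ, ih, Nat.choose_succ_succ' k 1, Nat.choose_one_right]
    ring

/-- The product `∏_{(i, k), k < s i} ∏_j (1 - x_j q ^ r_j / (x_i q ^ k))`. -/
def boxProd (x : Fin n → K) (q : K) (r s : Fin n → ℕ) : K :=
  ∏ t ∈ box s, ∏ j, (1 - qPoint x q ⟨j, r j⟩ / qPoint x q t)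

/-- The weight of `x_i q^(k+1)` against `x_i q^k` is zero, so `R` must be closed downwards along
each string of powers. -/
theorem exists_eq_box {x : Fin n → K} {q : K} {r : Fin n → ℕ} {R : Finset (Σ _ : Fin n, ℕ)}
    (hR : R ⊆ box r)
    (h : ∏ i ∈ R, ∏ j ∈ box r \ R, hlWeight q (qPoint x q) i j ≠ 0) :
    ∃ s ≤ r, box s = R := by
  have hdown : ∀ i k, (⟨i, k + 1⟩ : Σ _ : Fin n, ℕ) ∈ R → (⟨i, k⟩ : Σ _ : Fin n, ℕ) ∈ R := by
    intro i k hk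
    by_contra hn
    refine Finset.prod_ne_zero_iff.1 (Finset.prod_ne_zero_iff.1 h _ hk) ⟨i, k⟩ ?_ ?_
    · have := mem_box.1 (hR hk)
      exact Finset.mem_sdiff.2 ⟨mem_box.2 (by simp only at this ⊢; omega), hn⟩
    · simp only [hlWeight, qPoint]
      rw [show x i * q ^ (k + 1) - q * (x i * q ^ k) = 0 by ring, zero_div]
  have hdown' : ∀ i k, (⟨i, k⟩ : Σ _ : Fin n, ℕ) ∈ R → ∀ m ≤ k, (⟨i, m⟩ : Σ _ : Fin n, ℕ) ∈ R := by
    intro i k hk m hm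
    induction hm using Nat.decreasingInduction with
    | self => exact hk
    | of_succ m _ ih => exact hdown i m ih
  have hex : ∀ i, ∃ k, (⟨i, k⟩ : Σ _ : Fin n, ℕ) ∉ R := fun i =>
    ⟨r i, fun h => lt_irrefl _ (mem_box.1 (hR h))⟩
  classical
  have hbox : box (fun i => Nat.find (hex i)) = R := by
    ext ⟨i, k⟩
    rw [mem_box]
    constructor
    · intro hk
      exact not_not.1 (Nat.find_min (hex i) hk)
    · intro hk
      by_contra hle
      exact Nat.find_spec (hex i) (hdown' i k hk _ (not_lt.1 hle))
  exact ⟨_, box_subset_box.1 (by rwa [hbox]), hbox⟩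

theorem sum_powersetCard_box (x : Fin n → K) (q : K) (r : Fin n → ℕ) (m : ℕ)
    (g : Finset (Σ _ : Fin n, ℕ) → K) :
    ∑ R ∈ (box r).powersetCard m,
        (∏ i ∈ R, ∏ j ∈ box r \ R, hlWeight q (qPoint x q) i j) * g R =
      ∑ s ∈ (Finset.Iic r).filter (fun s => ∑ i, s i = m),
        (∏ i ∈ box s, ∏ j ∈ box r \ box s, hlWeight q (qPoint x q) i j) * g (box s) := by
  rw [← Finset.sum_image (g := box) (f := fun R =>
    (∏ i ∈ R, ∏ j ∈ box r \ R, hlWeight q (qPoint x q) i j) * g R) box_injective.injOn]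
  symm
  apply Finset.sum_subset
  · intro R hR
    obtain ⟨s, hs, rfl⟩ := Finset.mem_image.1 hR
    simp only [Finset.mem_filter, Finset.mem_Iic] at hs
    exact Finset.mem_powersetCard.2 ⟨box_subset_box.2 hs.1, by rw [card_box, hs.2]⟩
  · intro R hR hn
    obtain ⟨hR, hc⟩ := Finset.mem_powersetCard.1 hR
    by_contra h0
    obtain ⟨s, hs, rfl⟩ := exists_eq_box hR (left_ne_zero_of_mul h0)
    refine hn (Finset.mem_image_of_mem _ ?_)
    simp only [Finset.mem_filter, Finset.mem_Iic]
    exact ⟨hs, by rw [← card_box, hc]⟩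

variable {x : Fin n → K} {q : K}

theorem qPoint_ne_zero (hq : q ≠ 0) (hx : ∀ i, x i ≠ 0) (t : Σ _ : Fin n, ℕ) :
    qPoint x q t ≠ 0 := mul_ne_zero (hx _) (pow_ne_zero _ hq)

theorem one_sub_qPoint_div_ne_zero (hq : q ≠ 0) (hx : ∀ i, x i ≠ 0)
    (hinj : Function.Injective (qPoint x q)) {t u : Σ _ : Fin n, ℕ} (h : t ≠ u) :
    1 - qPoint x q t / qPoint x q u ≠ 0 := by
  rw [sub_ne_zero, Ne, eq_comm, div_eq_one_iff_eq (qPoint_ne_zero hq hx u)]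
  exact fun e => h (hinj e)

theorem boxProd_ne_zero (hq : q ≠ 0) (hx : ∀ i, x i ≠ 0)
    (hinj : Function.Injective (qPoint x q)) {r s : Fin n → ℕ} (hs : s ≤ r) :
    boxProd x q r s ≠ 0 := by
  refine Finset.prod_ne_zero_iff.2 fun t ht => Finset.prod_ne_zero_iff.2 fun j _ => ?_
  refine one_sub_qPoint_div_ne_zero hq hx hinj ?_
  rintro rfl
  exact (mem_box.1 (box_subset_box.2 hs ht)).ne rfl

/-- The product telescopes because `q` times the point `(j, m)` is the point `(j, m + 1)`. The
condition `ht` keeps `t` itself out of the range. -/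
theorem prod_Ico_hlWeight (hq : q ≠ 0) (hx : ∀ i, x i ≠ 0)
    (hinj : Function.Injective (qPoint x q)) (t : Σ _ : Fin n, ℕ) (j : Fin n) {a b : ℕ}
    (hab : a ≤ b) (ht : t.1 = j → t.2 < a) :
    ∏ m ∈ Finset.Ico a b, hlWeight q (qPoint x q) t ⟨j, m⟩ =
      (1 - qPoint x q ⟨j, b⟩ / qPoint x q t) / (1 - qPoint x q ⟨j, a⟩ / qPoint x q t) := by
  have hne : ∀ m, a ≤ m → 1 - qPoint x q ⟨j, m⟩ / qPoint x q t ≠ 0 := by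
    intro m hm
    refine one_sub_qPoint_div_ne_zero hq hx hinj ?_
    rintro rfl
    exact absurd (ht rfl) (by simpa using hm)
  have h0 := qPoint_ne_zero hq hx t
  induction hab with
  | refl => rw [Finset.Ico_self, Finset.prod_empty, div_self (hne a le_rfl)]
  | @step b hab ih =>
    rw [Finset.prod_Ico_succ_top hab, ih]
    have h1 := hne b hab
    have h2 := hne a le_rfl
    have h3 : qPoint x q t - qPoint x q ⟨j, b⟩ ≠ 0 := by
      intro h
      apply h1
      rw [← sub_eq_zero.1 h, div_self h0, sub_self]
    have h4 : qPoint x q ⟨j, b + 1⟩ = q * qPoint x q ⟨j, b⟩ := by simp only [qPoint]; ring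
    rw [hlWeight, h4, div_mul_eq_mul_div]
    congr 1
    field_simp

theorem prod_box_hlWeight (hq : q ≠ 0) (hx : ∀ i, x i ≠ 0)
    (hinj : Function.Injective (qPoint x q)) {r s : Fin n → ℕ} (hs : s ≤ r) :
    ∏ i ∈ box s, ∏ j ∈ box r \ box s, hlWeight q (qPoint x q) i j =
      boxProd x q r s / boxProd x q s s := by
  rw [boxProd, boxProd, ← Finset.prod_div_distrib]
  refine Finset.prod_congr rfl fun t ht => ?_
  rw [box_sdiff_box, Finset.prod_sigma, ← Finset.prod_div_distrib]
  refine Finset.prod_congr rfl fun j _ => ?_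
  refine prod_Ico_hlWeight hq hx hinj t j (hs j) ?_
  rintro rfl
  exact mem_box.1 ht

/-- For negative `m` the factor `1 - a q^m` stands in a denominator, where the convention that zero
has inverse zero would break the recurrence. -/
theorem qPoch_succ {L : Type*} [Field L] {a q : L} (m : ℤ) (h : 1 - a * q ^ m ≠ 0) :
    qPoch a q (m + 1) = qPoch a q m * (1 - a * q ^ m) := by
  obtain ⟨k, rfl | rfl⟩ := m.eq_nat_or_neg
  · exact_mod_cast Finset.prod_range_succ _ _
  · obtain _ | k := k
    · simp [qPoch]
    · have e1 : (-((k + 1 : ℕ) : ℤ)) = Int.negSucc k := rfl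
      have h' : a * q⁻¹ ^ (k + 1) = a * q ^ (-((k + 1 : ℕ) : ℤ)) := by
        rw [zpow_neg, zpow_natCast, inv_pow]
      rw [← h'] at h ⊢
      rw [e1]
      have e2 : qPoch a q (Int.negSucc k) =
          (∏ i ∈ Finset.range (k + 1), (1 - a * q⁻¹ ^ (i + 1)))⁻¹ := rfl
      rw [e2, Finset.prod_range_succ, mul_inv, mul_assoc, inv_mul_cancel₀ h, mul_one]
      obtain _ | k := k
      · simp [qPoch]
      · rfl

theorem qPoch_ne_zero {L : Type*} [Field L] {a q : L} (m : ℤ)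
    (h : ∀ k : ℤ, a * q ^ k ≠ 1) : qPoch a q m ≠ 0 := by
  rcases m with k | k
  · refine Finset.prod_ne_zero_iff.2 fun i _ => sub_ne_zero.2 ?_
    simpa using (h i).symm
  · refine inv_ne_zero (Finset.prod_ne_zero_iff.2 fun i _ => sub_ne_zero.2 ?_)
    have := (h (-((i + 1 : ℕ) : ℤ))).symm
    rwa [zpow_neg, zpow_natCast, ← inv_pow] at this

theorem qPoch_div_qPoch {L : Type*} [Field L] {a q : L} {A : ℤ} {b c : ℕ}
    (hcb : c ≤ b) (h0 : qPoch a q (A - c) ≠ 0)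
    (h : ∀ t ∈ Finset.Ico c b, 1 - a * q ^ (A - t - 1) ≠ 0) :
    qPoch a q (A - b) / qPoch a q (A - c) =
      (∏ t ∈ Finset.Ico c b, (1 - a * q ^ (A - t - 1)))⁻¹ := by
  induction hcb with
  | refl => simp [div_self h0]
  | @step b hcb ih =>
    have hcb' : c ≤ b := hcb
    rw [Finset.prod_Ico_succ_top hcb, mul_inv, ← ih fun t ht => h t (by
      simp only [Finset.mem_Ico] at ht ⊢; omega)]
    have h1 := h b (by simp only [Finset.mem_Ico]; omega)
    have h2 := qPoch_succ _ h1
    rw [show A - b - 1 + 1 = A - b by ring] at h2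
    rw [h2, show A - ((b + 1 : ℕ) : ℤ) = A - b - 1 by push_cast; ring]
    field_simp

/-- For each pair `i, j` the quotient of shifted factorials is the inverse product of `1 - x_i
q^(r_i) / (x_j q^t)` over `s_j ≤ t < r_j`. These are the factors of `boxProd x q r r` outside `box
s`. -/
theorem hyperTerm_eq (hq : q ≠ 0) (hq1 : ∀ k, 0 < k → q ^ k ≠ 1) (hx : ∀ i, x i ≠ 0)
    (hinj : Function.Injective (qPoint x q)) {r s : Fin n → ℕ} (hs : s ≤ r) :
    hyperTerm 1 r s x q =
      (∏ t ∈ box r, qPoint x q t) * (boxProd x q r s / boxProd x q r r) := by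
  have hfac : ∀ (i j : Fin n) (t : ℕ), q * x i / x j * q ^ ((r i : ℤ) - t - 1) =
      qPoint x q ⟨i, r i⟩ / qPoint x q ⟨j, t⟩ := by
    intro i j t
    simp only [qPoint]
    have := hx j
    rw [zpow_sub₀ hq, zpow_sub₀ hq, zpow_natCast, zpow_natCast, zpow_one]
    field_simp
  have hfac0 : ∀ (i j : Fin n) (t : ℕ), t ∈ Finset.Ico (s j) (r j) →
      1 - q * x i / x j * q ^ ((r i : ℤ) - t - 1) ≠ 0 := by
    intro i j t ht
    rw [hfac]
    refine one_sub_qPoint_div_ne_zero hq hx hinj ?_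
    intro h
    obtain rfl : i = j := congrArg Sigma.fst h
    have : r i = t := by simpa using h
    simp only [Finset.mem_Ico] at ht
    omega
  have h0 : ∀ i j : Fin n, qPoch (q * x i / x j) q ((r i : ℤ) - s j) ≠ 0 := by
    intro i j
    by_cases hij : i = j
    · subst hij
      rw [mul_div_cancel_right₀ _ (hx i), ← Nat.cast_sub (hs i)]
      exact qPoch_self_ne_zero hq1 _
    · refine qPoch_ne_zero _ fun k hk => ?_
      obtain ⟨m, rfl | rfl⟩ := k.eq_nat_or_neg
      · have : qPoint x q ⟨i, m + 1⟩ = qPoint x q ⟨j, 0⟩ := by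
          have := hx j
          simp only [qPoint]
          rw [zpow_natCast] at hk
          field_simp at hk
          rw [← hk]; ring
        exact hij (congrArg Sigma.fst (hinj this))
      · have : qPoint x q ⟨i, 1⟩ = qPoint x q ⟨j, m⟩ := by
          have := hx j
          simp only [qPoint]
          rw [zpow_neg, zpow_natCast] at hk
          field_simp at hk
          rw [← hk]; ring
        exact hij (congrArg Sigma.fst (hinj this))
  have hsplit : boxProd x q r r = (∏ t ∈ box r \ box s,
      ∏ j, (1 - qPoint x q ⟨j, r j⟩ / qPoint x q t)) * boxProd x q r s :=
    (Finset.prod_sdiff (box_subset_box.2 hs)).symm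
  rw [hyperTerm, prod_box_qPoint]
  simp only [zpow_one]
  congr 1
  rw [hsplit, mul_comm _ (boxProd x q r s), div_mul_cancel_left₀ (boxProd_ne_zero hq hx hinj hs),
    box_sdiff_box, Finset.prod_sigma, Finset.prod_comm, ← Finset.prod_inv_distrib]
  refine Finset.prod_congr rfl fun j _ => ?_
  rw [Finset.prod_comm, ← Finset.prod_inv_distrib]
  refine Finset.prod_congr rfl fun i _ => ?_
  rw [qPoch_div_qPoch (hs j) (h0 i j) (hfac0 i j)]
  simp only [hfac]

end Box

/-! ### Chains of boxes and the iterated recursion. -/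

section Chains

variable {n : ℕ}

/-- The sequences `r ⊇ ρ^{(1)} ⊇ ρ^{(2)} ⊇ ⋯` with `|ρ^{(ℓ)}| = lam'_{c + ℓ}`. -/
def chainFromSet (lam : YoungDiagram) (c : ℕ) (r : Fin n → ℕ) : Set (ℕ → Fin n → ℕ) :=
  {ρ | Antitone ρ ∧ ρ 0 ≤ r ∧ ∀ l, ∑ i, ρ l i = lam.colLen (c + l)}

theorem eq_zero_of_mem_chainFromSet {lam : YoungDiagram} {c : ℕ} {r : Fin n → ℕ}
    {ρ : ℕ → Fin n → ℕ} (hρ : ρ ∈ chainFromSet lam c r) {l : ℕ} (h : lam.rowLen 0 ≤ c + l) :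
    ρ l = 0 := by
  have h1 := hρ.2.2 l
  rw [colLen_eq_zero_of_rowLen_le lam h, Finset.sum_eq_zero_iff] at h1
  funext i
  exact h1 i (Finset.mem_univ i)

theorem chainFromSet_finite (lam : YoungDiagram) (c : ℕ) (r : Fin n → ℕ) :
    (chainFromSet lam c r).Finite := by
  let g : (ℕ → Fin n → ℕ) → (Fin (lam.rowLen 0) → Fin n → ℕ) := fun ρ l => ρ l
  refine Set.Finite.of_finite_image (f := g) ((Set.finite_Iic fun _ => r).subset ?_) ?_
  · rintro _ ⟨ρ, hρ, rfl⟩ l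
    exact (hρ.1 (Nat.zero_le _)).trans hρ.2.1
  · intro ρ hρ ρ' hρ' h
    funext l
    by_cases hl : l < lam.rowLen 0
    · exact congrFun h ⟨l, hl⟩
    · rw [eq_zero_of_mem_chainFromSet hρ (by omega), eq_zero_of_mem_chainFromSet hρ' (by omega)]

/-- The finite set of the sequences in `chainFromSet`. -/
noncomputable def chainsFrom (lam : YoungDiagram) (c : ℕ) (r : Fin n → ℕ) :
    Finset (ℕ → Fin n → ℕ) := (chainFromSet_finite lam c r).toFinset

theorem mem_chainsFrom {lam : YoungDiagram} {c : ℕ} {r : Fin n → ℕ} {ρ : ℕ → Fin n → ℕ} :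
    ρ ∈ chainsFrom lam c r ↔
      Antitone ρ ∧ ρ 0 ≤ r ∧ ∀ l, ∑ i, ρ l i = lam.colLen (c + l) :=
  (chainFromSet_finite lam c r).mem_toFinset

theorem chainsFrom_of_rowLen_le {lam : YoungDiagram} {c : ℕ} (hc : lam.rowLen 0 ≤ c)
    (r : Fin n → ℕ) : chainsFrom lam c r = {0} := by
  ext ρ
  rw [Finset.mem_singleton]
  constructor
  · intro h
    funext l
    exact eq_zero_of_mem_chainFromSet (mem_chainsFrom.1 h) (by omega)
  · rintro rfl
    refine mem_chainsFrom.2 ⟨antitone_const, fun _ => Nat.zero_le _, fun l => ?_⟩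
    rw [colLen_eq_zero_of_rowLen_le lam (by omega)]
    simp

theorem sum_chainsFrom {M : Type*} [AddCommMonoid M] (lam : YoungDiagram) (c : ℕ)
    (r : Fin n → ℕ) (g : (Fin n → ℕ) → (ℕ → Fin n → ℕ) → M) :
    ∑ ρ ∈ chainsFrom lam c r, g (ρ 0) (fun l => ρ (l + 1)) =
      ∑ s ∈ (Finset.Iic r).filter (fun s => ∑ i, s i = lam.colLen c),
        ∑ ρ ∈ chainsFrom lam (c + 1) s, g s ρ := by
  rw [Finset.sum_sigma']
  refine Finset.sum_bij' (fun ρ _ => ⟨ρ 0, fun l => ρ (l + 1)⟩)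
    (fun t _ => fun l => Nat.casesOn l t.1 t.2) ?_ ?_ ?_ ?_ ?_
  · intro ρ hρ
    obtain ⟨h1, h2, h3⟩ := mem_chainsFrom.1 hρ
    simp only [Finset.mem_sigma, Finset.mem_filter, Finset.mem_Iic, mem_chainsFrom]
    refine ⟨⟨h2, h3 0⟩, fun a b hab => h1 (by omega), h1 (by omega), fun l => ?_⟩
    rw [h3, Nat.add_right_comm, Nat.add_assoc]
  · rintro ⟨s, ρ⟩ h
    simp only [Finset.mem_sigma, Finset.mem_filter, Finset.mem_Iic, mem_chainsFrom] at h
    obtain ⟨⟨h1, h2⟩, h3, h4, h5⟩ := h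
    refine mem_chainsFrom.2 ⟨antitone_nat_of_succ_le fun l => ?_, h1, fun l => ?_⟩
    · cases l with
      | zero => exact h4
      | succ l => exact h3 (Nat.le_succ l)
    · cases l with
      | zero => exact h2
      | succ l => exact (h5 l).trans (by rw [Nat.add_right_comm, Nat.add_assoc])
  · intro ρ _
    funext l
    cases l <;> rfl
  · rintro ⟨s, ρ⟩ _
    rfl
  · intro ρ _
    rfl

variable {K : Type*} [Field K] {x : Fin n → K} {q : K}

/-- The Hall–Littlewood polynomial at the points `x_i q ^ k` with `k < r i`. -/
theorem hlColumn_box (hq : q ≠ 0) (hq1 : ∀ k, 0 < k → q ^ k ≠ 1) (hx : ∀ i, x i ≠ 0)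
    (hinj : Function.Injective (qPoint x q)) (lam : YoungDiagram) (d c : ℕ)
    (hd : lam.rowLen 0 ≤ c + d) (r : Fin n → ℕ) (hr : lam.colLen c ≤ ∑ i, r i) :
    hlColumn q (qPoint x q) lam c (box r) = ∑ ρ ∈ chainsFrom lam c r,
      boxProd x q r (ρ 0) * ∏ l ∈ Finset.range d, hyperTerm 1 (ρ l) (ρ (l + 1)) x q := by
  -- `d` bounds the number of columns still to be removed, starting from column `c`.
  induction d generalizing c r with
  | zero =>
    rw [hlColumn_of_rowLen_le hq1 lam (c := c) hd hinj.injOn,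
      chainsFrom_of_rowLen_le (c := c) hd]
    simp [boxProd, box_zero]
  | succ d ih =>
    rw [hlColumn_recursion hq1 lam c hinj.injOn (by rwa [card_box])]
    simp only [mul_assoc]
    rw [sum_powersetCard_box x q r (lam.colLen c) fun R =>
      (∏ t ∈ R, qPoint x q t) * hlColumn q (qPoint x q) lam (c + 1) R]
    simp only [Finset.prod_range_succ']
    rw [sum_chainsFrom lam c r fun s ρ => boxProd x q r s *
      ((∏ l ∈ Finset.range d, hyperTerm 1 (ρ l) (ρ (l + 1)) x q) * hyperTerm 1 s (ρ 0) x q)]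
    refine Finset.sum_congr rfl fun s hs => ?_
    simp only [Finset.mem_filter, Finset.mem_Iic] at hs
    rw [prod_box_hlWeight hq hx hinj hs.1, ih (c + 1) (by omega) s
      (by rw [hs.2]; exact lam.colLen_anti _ _ (Nat.le_succ c)), Finset.mul_sum, Finset.mul_sum]
    refine Finset.sum_congr rfl fun ρ hρ => ?_
    -- The denominator `boxProd x q s s` of the weight and the factor `boxProd x q s (ρ 0)` from the
    -- inner sum combine with the product of the points into the term for `s` and `ρ 0`.
    rw [hyperTerm_eq hq hq1 hx hinj (mem_chainsFrom.1 hρ).2.1]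
    have := boxProd_ne_zero hq hx hinj (le_refl s)
    field_simp

end Chains

/-! ### Interpolation in `z = q^M` and the final formula. -/

section Theorem

theorem RatFun.q_pow_ne_one (n : ℕ) (k : ℕ) (hk : 0 < k) : RatFun.q n ^ k ≠ 1 := by
  rw [RatFun.q_eq]
  exact algebraMap_qVar_pow_ne_one _ k hk

theorem RatFun.q_ne_zero (n : ℕ) : RatFun.q n ≠ 0 := by
  rw [RatFun.q_eq]
  exact (map_ne_zero _).2 qVar_ne_zero

theorem RatFun.q_pow_injective (n : ℕ) : Function.Injective fun k : ℕ => RatFun.q n ^ k := by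
  intro k m h
  wlog hle : k ≤ m generalizing k m
  · exact (this h.symm (by omega)).symm
  obtain ⟨d, rfl⟩ := Nat.exists_eq_add_of_le hle
  have h' : RatFun.q n ^ k * 1 = RatFun.q n ^ k * RatFun.q n ^ d := by
    rw [mul_one, ← pow_add]; exact h
  have h1 := mul_left_cancel₀ (pow_ne_zero k (RatFun.q_ne_zero n)) h'
  by_contra hd
  exact RatFun.q_pow_ne_one n d (by omega) h1.symm

theorem RatFun.qPoint_injective (n : ℕ) :
    Function.Injective (qPoint (RatFun.x : Fin n → RatFun n) (RatFun.q n)) := by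
  rintro ⟨i, k⟩ ⟨j, m⟩ h
  simp only [qPoint] at h
  have hij : i = j := by
    by_contra hij
    have h1 : algebraMap (MvPolynomial (Fin n) QField) (RatFun n)
        (MvPolynomial.C (qVar ^ k) * MvPolynomial.X i) =
        algebraMap _ _ (MvPolynomial.C (qVar ^ m) * MvPolynomial.X j) := by
      simp only [map_mul, map_pow]
      rw [mul_comm, mul_comm (_ ^ m)]
      exact h
    have h2 := congrArg (MvPolynomial.coeff (Finsupp.single i 1))
      (IsFractionRing.injective _ (RatFun n) h1)
    have hne : Finsupp.single j 1 ≠ Finsupp.single i 1 := fun h =>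
      hij (Finsupp.single_left_injective one_ne_zero h).symm
    rw [MvPolynomial.coeff_C_mul, MvPolynomial.coeff_C_mul, MvPolynomial.coeff_X,
      MvPolynomial.coeff_X, if_pos rfl, if_neg hne, mul_one, mul_zero] at h2
    exact pow_ne_zero k qVar_ne_zero h2
  subst hij
  have h1 := RatFun.q_pow_injective n (mul_left_cancel₀ (RatFun.x_ne_zero i) h)
  rw [h1]

/-- `P'_lam` is obtained from `P_lam` by `p_r ↦ ∑ i, x_i ^ r / (1 - q ^ r)`. -/
theorem algebraMap_modifiedP (n : ℕ) (lam : YoungDiagram) :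
    algebraMap (MvPolynomial (Fin n) QField) (RatFun n) (modifiedP n lam) =
      MvPolynomial.aeval (fun r : ℕ+ => (∑ i, RatFun.x i ^ (r : ℕ)) / (1 - RatFun.q n ^ (r : ℕ)))
        (hallLittlewoodP lam) := by
  have hb : hlB lam qVar ≠ 0 := hlB_ne_zero (fun k hk => qVar_pow_ne_one hk) lam
  have h1 : modifiedP n lam = SymmFun.inVars n (plethysmDivOneSub (hallLittlewoodP lam)) := by
    have hC : ∀ c : QField, SymmFun.inVars n (plethysmDivOneSub (MvPolynomial.C c)) =
        MvPolynomial.C c := fun c => by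
      rw [← MvPolynomial.algebraMap_eq, AlgHom.commutes, AlgHom.commutes,
        MvPolynomial.algebraMap_eq]
    rw [modifiedP, modifiedQ, hallLittlewoodQ, map_mul, map_mul, hC, ← mul_assoc, ← map_mul,
      inv_mul_cancel₀ hb, map_one, one_mul]
  have h2 : (IsScalarTower.toAlgHom QField (MvPolynomial (Fin n) QField) (RatFun n)).comp
      ((SymmFun.inVars n).comp plethysmDivOneSub) = MvPolynomial.aeval
        (fun r : ℕ+ => (∑ i, RatFun.x i ^ (r : ℕ)) / (1 - RatFun.q n ^ (r : ℕ))) := by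
    refine MvPolynomial.algHom_ext fun r => ?_
    have hC : SymmFun.inVars n (MvPolynomial.C (1 - qVar ^ (r : ℕ))⁻¹) =
        MvPolynomial.C (1 - qVar ^ (r : ℕ))⁻¹ := by
      rw [← MvPolynomial.algebraMap_eq, AlgHom.commutes, MvPolynomial.algebraMap_eq]
    rw [AlgHom.comp_apply, AlgHom.comp_apply, plethysmDivOneSub, MvPolynomial.aeval_X,
      MvPolynomial.aeval_X, map_mul, hC, SymmFun.inVars_X, IsScalarTower.coe_toAlgHom', map_mul,
      ← MvPolynomial.algebraMap_eq, ← IsScalarTower.algebraMap_apply, map_inv₀, map_sub, map_one,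
      map_pow, ← RatFun.q_eq, div_eq_mul_inv, mul_comm]
    simp [MvPolynomial.psum, RatFun.x]
  rw [h1]
  exact DFunLike.congr_fun h2 _

theorem chainsFrom_zero_eq_chains {n : ℕ} (lam : YoungDiagram) {M : ℕ} (hM : lam.colLen 0 ≤ M) :
    chainsFrom lam 0 (fun _ : Fin n => M) = chains n lam := by
  ext ρ
  rw [mem_chainsFrom, chains, Set.Finite.mem_toFinset]
  simp only [zero_add]
  constructor
  · exact fun h => ⟨h.1, h.2.2⟩
  · rintro ⟨h1, h2⟩
    refine ⟨h1, fun i => ?_, h2⟩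
    exact ((Finset.single_le_sum (fun _ _ => Nat.zero_le _) (Finset.mem_univ i)).trans
      (h2 0).le).trans hM

/-- A symmetric function at the points of a finite set. -/
theorem aeval_sum_pow_eq_hlColumn {K ι : Type*} [Field K] [Algebra QField K] [DecidableEq ι]
    {lam : YoungDiagram} {F : SymmFun} (hF : IsHallLittlewood lam F) {y : ι → K} {S : Finset ι}
    (hy : Set.InjOn y S) (hS : lam.colLen 0 ≤ S.card) :
    MvPolynomial.aeval (fun r : ℕ+ => ∑ t ∈ S, y t ^ (r : ℕ)) F =
      hlColumn (algebraMap QField K qVar) y lam 0 S := by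
  let f : Fin S.card ↪ ι := S.equivFin.symm.toEmbedding.trans (Function.Embedding.subtype _)
  have hf : Finset.univ.map f = S := by
    ext t
    simp only [Finset.mem_map, Finset.mem_univ, true_and]
    constructor
    · rintro ⟨i, rfl⟩
      exact (S.equivFin.symm i).2
    · intro ht
      exact ⟨S.equivFin ⟨t, ht⟩, by simp [f]⟩
  have h := aeval_eq_hlColumn (hF S.card hS) f (y := y) (by rwa [hf])
  rw [hf] at h
  rw [← h, SymmFun.inVars, MvPolynomial.comp_aeval_apply]
  congr 2
  funext r
  conv_lhs => rw [← hf]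
  simp [MvPolynomial.psum]

-- The exclusion of `n = 0` with nonempty `λ` is needed because there are then no points at all,
-- never reaching `l(λ)` of them.
open Polynomial in
theorem algebraMap_modifiedP_eq_sum (n : ℕ) (lam : YoungDiagram)
    (h : n = 0 → lam.colLen 0 = 0) :
    algebraMap (MvPolynomial (Fin n) QField) (RatFun n) (modifiedP n lam) =
      ∑ ρ ∈ chains n lam, ∏ l ∈ Finset.range (lam.rowLen 0),
        hyperTerm 1 (ρ l) (ρ (l + 1)) RatFun.x (RatFun.q n) := by
  set q := RatFun.q n with hq
  let x : Fin n → RatFun n := RatFun.x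
  -- The polynomial variable of `A` and `B` plays the role of `z = q^M`.
  let A : (RatFun n)[X] := MvPolynomial.aeval (fun r : ℕ+ =>
    C ((∑ i, x i ^ (r : ℕ)) / (1 - q ^ (r : ℕ))) * (1 - X ^ (r : ℕ))) (hallLittlewoodP lam)
  let B : (RatFun n)[X] := ∑ ρ ∈ chains n lam,
    (∏ t ∈ box (ρ 0), ∏ j, (1 - C (x j / qPoint x q t) * X)) *
      C (∏ l ∈ Finset.range (lam.rowLen 0), hyperTerm 1 (ρ l) (ρ (l + 1)) x q)
  have hA : ∀ z, eval z A = MvPolynomial.aeval (fun r : ℕ+ =>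
      (∑ i, x i ^ (r : ℕ)) / (1 - q ^ (r : ℕ)) * (1 - z ^ (r : ℕ))) (hallLittlewoodP lam) := by
    intro z
    have := MvPolynomial.comp_aeval_apply (R := QField)
      (f := fun r : ℕ+ => C ((∑ i, x i ^ (r : ℕ)) / (1 - q ^ (r : ℕ))) * (1 - X ^ (r : ℕ)))
      ((Polynomial.aeval (R := RatFun n) z).restrictScalars QField) (hallLittlewoodP lam)
    simp only [AlgHom.restrictScalars_apply, Polynomial.coe_aeval_eq_eval] at this
    rw [this]
    simp
  have hAB : A = B := by
    refine Polynomial.eq_of_infinite_eval_eq A B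
      (((Set.Ici_infinite (lam.colLen 0)).image (RatFun.q_pow_injective n).injOn).mono ?_)
    rintro _ ⟨M, hM, rfl⟩
    have hM' : lam.colLen 0 ≤ ∑ _i : Fin n, M := by
      rcases Nat.eq_zero_or_pos n with h0 | h0
      · rw [h h0]; exact Nat.zero_le _
      · simp only [Finset.sum_const, Finset.card_univ, Fintype.card_fin, smul_eq_mul]
        exact le_trans hM (Nat.le_mul_of_pos_left M h0)
    have h1 := aeval_sum_pow_eq_hlColumn (K := RatFun n) (isHallLittlewood_hallLittlewoodP lam)
      (S := box fun _ : Fin n => M) (RatFun.qPoint_injective n).injOn (by rwa [card_box])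
    rw [← RatFun.q_eq, hlColumn_box (RatFun.q_ne_zero n) (RatFun.q_pow_ne_one n) RatFun.x_ne_zero
      (RatFun.qPoint_injective n) lam (lam.rowLen 0) 0 (by simp) _ hM',
      chainsFrom_zero_eq_chains lam hM] at h1
    change eval _ A = eval _ B
    rw [hA]
    simp only [B, eval_finsetSum, eval_mul, eval_prod, eval_sub, eval_one, eval_C, eval_X]
    have hp : (fun r : ℕ+ => (∑ i, x i ^ (r : ℕ)) / (1 - q ^ (r : ℕ)) *
        (1 - (q ^ M) ^ (r : ℕ))) =
        fun r : ℕ+ => ∑ t ∈ box fun _ : Fin n => M, qPoint RatFun.x (RatFun.q n) t ^ (r : ℕ) := by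
      funext r
      have hr : 1 - q ^ (r : ℕ) ≠ 0 := sub_ne_zero.2 (RatFun.q_pow_ne_one n r r.pos).symm
      rw [box, Finset.sum_sigma, div_mul_eq_mul_div, div_eq_iff hr, Finset.sum_mul, Finset.sum_mul]
      refine Finset.sum_congr rfl fun i _ => ?_
      simp only [qPoint, mul_pow, ← Finset.mul_sum]
      rw [mul_assoc]
      congr 1
      rw [← pow_mul, mul_comm M, pow_mul, ← mul_neg_geom_sum, mul_comm]
      congr 1
      refine Finset.sum_congr rfl fun k _ => ?_
      rw [← pow_mul, ← pow_mul, mul_comm]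
    rw [hp, h1]
    refine Finset.sum_congr rfl fun ρ _ => ?_
    rw [boxProd]
    congr 1
    refine Finset.prod_congr rfl fun t _ => Finset.prod_congr rfl fun j _ => ?_
    rw [div_mul_eq_mul_div]
    rfl
  -- At `z = 0` the power sums become those of `x / (1 - q)`, and every factor of the outermost box
  -- product becomes `1`.
  have h0 := congrArg (eval 0) hAB
  rw [hA] at h0
  rw [algebraMap_modifiedP]
  convert h0 using 1
  · congr 2
    funext r
    simp [x, hq]
  · simp [B, eval_finsetSum, eval_prod, x]

theorem mainTheorem3 (n : ℕ) (lam : YoungDiagram) :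
    algebraMap (MvPolynomial (Fin n) QField) (RatFun n) (modifiedP n lam) =
      ∑ r ∈ chains n lam, ∏ᶠ l : ℕ, hyperTerm 1 (r l) (r (l + 1)) RatFun.x (RatFun.q n) := by
  by_cases h : n = 0 → lam.colLen 0 = 0
  · rw [algebraMap_modifiedP_eq_sum n lam h]
    refine Finset.sum_congr rfl fun r hr => (finprod_eq_prod_of_mulSupport_subset _ ?_).symm
    intro l hl
    rw [Finset.coe_range, Set.mem_Iio]
    by_contra hle
    have hr' : r ∈ chainSet n lam := (chainSet_finite n lam).mem_toFinset.1 hr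
    refine hl ?_
    simp only [eq_zero_of_mem_chainSet hr' (not_lt.1 hle),
      eq_zero_of_mem_chainSet hr' ((not_lt.1 hle).trans (Nat.le_succ l)), hyperTerm_zero_zero]
  -- No variables and a nonempty `λ`: there are no chains, and `P'_λ` reduces to the constant term
  -- of `P_λ`, which is zero.
  · push Not at h
    obtain ⟨rfl, h⟩ := h
    have hempty : chains 0 lam = ∅ := by
      refine Finset.eq_empty_of_forall_notMem fun r hr => h ?_
      have hr' : r ∈ chainSet 0 lam := (chainSet_finite 0 lam).mem_toFinset.1 hr
      simpa using (hr'.2 0).symm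
    rw [hempty, Finset.sum_empty, algebraMap_modifiedP]
    simp [constantCoeff_eq_zero_of_isHallLittlewood h (isHallLittlewood_hallLittlewoodP lam),
      MvPolynomial.aeval_zero']

end Theorem
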